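/- Throughout, "$A^*$-algebra" means either "$C^*$-algebra" or "$W^*$-algebra", and $A^*$-correspondences are understood in the corresponding setting. An $A^*$-correspondence over $\mathcal M$ is a right Hilbert $\mathcal M$-module with a nondegenerate left action of $\mathcal M$ by adjointable operators; in the $W^*$-setting the module is self-dual and the left action is normal. A representation of $\mathcal M$ on a Hilbert space is a nondegenerate $*$-homomorphism $\mathcal M\to B(\mathcal H)$, which is normal in the $W^*$-setting. Let $X=(X(n))_{n\in\mathbb Z_+}$ be a subproduct system over an $A^*$-algebra $\mathcal M$, i.e. $X(0)=\mathcal M$, the $X(n)$ are $A^*$-correspondences over $\mathcal M$, and there are coisometric adjointable bimodule maps $U_{n,m}:X(n)\otimes X(m)\to X(n+m)$ such that $U_{n,0}$, $U_{0,n}$ are the right and left actions of $\mathcal M$ and $U_{n+m,l}(U_{n,m}\otimes I)=U_{n,m+l}(I\otimes U_{m,l})$. (This includes every standard subproduct system, where $X(n+m)$ is an orthogonally complementable sub-bimodule of $X(n)\otimes X(m)$ and $U_{n,m}$ is the projection onto it.) Let $\mathcal F_X=\bigoplus_n X(n)$, and let $S_n(\zeta)$, $\zeta\in X(n)$, be the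 creation operators on $\mathcal F_X$, $S_n(\zeta)\eta=U_{n,m}(\zeta\otimes\eta)$ for $\eta\in X(m)$. For a representation $\pi$ of $\mathcal M$ on $\mathcal D$, $\mathcal F_X\otimes_\pi\mathcal D$ is the interior tensor product, a Hilbert space with $\langle\xi\otimes d,\eta\otimes e\rangle=\langle d,\pi(\langle\xi,\eta\rangle)e\rangle$. Let $T=(T_n)_{n\in\mathbb Z_+}$ be a completely contractive covariant representation of $X$ on a Hilbert space $\mathcal H$: the maps $T_n:X(n)\to B(\mathcal H)$ are linear and completely contractive, $\sigma:=T_0$ is a representation of $\mathcal M$, $T_n(a\xi b)=\sigma(a)T_n(\xi)\sigma(b)$, and $T_{n+m}(U_{n,m}(\xi\otimes\eta))=T_n(\xi)T_m(\eta)$. Let $\widetilde T_n:X(n)\otimes_\sigma\mathcal H\to\mathcal H$, $\widetilde T_n(\xi\otimes h)=T_n(\xi)h$, and suppose that $T$ is pure, i.e. $\widetilde T_n\widetilde T_n^*\to0$ in the strong operator topology. Let $\mathcal S$ be a closed subspace of $\mathcal H$. Then $\mathcal S$ is invariant for $T$ (that is, $T_n(\zeta)\mathcal S\subseteq\mathcal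 S$ for all $n\in\mathbb Z_+$ and $\zeta\in X(n)$) if and only if there exist a Hilbert space $\mathcal D$, a representation $\pi$ of $\mathcal M$ on $\mathcal D$, and a bounded linear operator $\Pi:\mathcal F_X\otimes_\pi\mathcal D\to\mathcal H$ such that $P_{\mathcal S}=\Pi\Pi^*$, where $P_{\mathcal S}$ is the orthogonal projection onto $\mathcal S$, and $$\Pi\,(S_n(\zeta)\otimes I_{\mathcal D})=T_n(\zeta)\,\Pi\qquad(\zeta\in X(n),\ n\in\mathbb Z_+).$$ -/

import Mathlib

open scoped TensorProduct ComplexOrder DirectSum Topology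
open MulOpposite (op unop)

universe u v w x

noncomputable section

namespace CovariantRep

/-! ## Hilbert modules

Mathlib's `CStarModule A E` is linear over `A` on the left. A (right) Hilbert module over `M` is
therefore a `CStarModule Mᵐᵒᵖ E`: the right action of `a : M` on `ξ : E` is `op a • ξ`, and the
`M`-valued inner product, which is linear in the second variable and satisfies
`⟨ξ, η a⟩ = ⟨ξ, η⟩ a`, is `hinner M ξ η`. -/

/-- Helper for the positivity of Gram matrices: the negative part `b` of a selfadjoint element `G`
satisfies `b G b = - R⋆ R` with `R = b^(3/2)`, and `G` is positive if `R = 0`. -/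
lemma exists_of_isSelfAdjoint {A : Type*} [NonUnitalCStarAlgebra A] {G : A}
    (hG : IsSelfAdjoint G) :
    ∃ b R : A, star R * R = -(star b * (G * b)) ∧ (R = 0 → ∃ Q, G = star Q * Q) := by
  let : PartialOrder A := CStarAlgebra.spectralOrder A
  have : StarOrderedRing A := CStarAlgebra.spectralOrderedRing A
  have hb0 : 0 ≤ G⁻ := CFC.negPart_nonneg G
  have hbs : star G⁻ = G⁻ := hb0.isSelfAdjoint.star_eq
  have hdec : G⁺ - G⁻ = G := CFC.posPart_sub_negPart G hG
  have hmul : G⁺ * G⁻ = 0 := CFC.posPart_mul_negPart G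
  have hGb : G * G⁻ = -(G⁻ * G⁻) := by
    nth_rewrite 1 [← hdec]
    rw [sub_mul, hmul, zero_sub]
  have hrs : star (CFC.sqrt G⁻) = CFC.sqrt G⁻ := (CFC.sqrt_nonneg G⁻).isSelfAdjoint.star_eq
  have hrr : CFC.sqrt G⁻ * CFC.sqrt G⁻ = G⁻ := CFC.sqrt_mul_sqrt_self G⁻ hb0
  refine ⟨G⁻, CFC.sqrt G⁻ * G⁻, ?_, fun hR => ?_⟩
  · rw [star_mul, hrs, hGb, hbs, mul_neg, neg_neg, mul_assoc, ← mul_assoc (CFC.sqrt G⁻) _ G⁻, hrr]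
  · have hbb : star G⁻ * G⁻ = 0 := by
      rw [hbs]
      nth_rewrite 1 [← hrr]
      rw [mul_assoc, hR, mul_zero]
    have hb' : G⁻ = 0 := (CStarRing.star_mul_self_eq_zero_iff _).1 hbb
    have hpos : 0 ≤ G := by
      rw [← hdec, hb', sub_zero]
      exact CFC.posPart_nonneg G
    exact CStarAlgebra.nonneg_iff_eq_star_mul_self.1 hpos

section HilbertModule

variable (M : Type u) [NonUnitalCStarAlgebra M] [PartialOrder M]
variable {E : Type v} [AddCommGroup E] [Module ℂ E] [SMul Mᵐᵒᵖ E] [Norm E] [CStarModule Mᵐᵒᵖ E]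

/-- The `M`-valued inner product of a right Hilbert `M`-module. -/
def hinner (ξ η : E) : M := unop (inner Mᵐᵒᵖ ξ η)

lemma hinner_add_right (ξ η ζ : E) : hinner M ξ (η + ζ) = hinner M ξ η + hinner M ξ ζ := by
  simp [hinner]

lemma hinner_smul_right (c : ℂ) (ξ η : E) : hinner M ξ (c • η) = c • hinner M ξ η := by
  simp [hinner]

lemma hinner_op_smul_right (a : M) (ξ η : E) : hinner M ξ (op a • η) = hinner M ξ η * a := by
  simp [hinner]

lemma star_hinner (ξ η : E) : star (hinner M ξ η) = hinner M η ξ := by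
  rw [hinner, hinner, ← CStarModule.star_inner (A := Mᵐᵒᵖ) ξ η, MulOpposite.unop_star]

lemma hinner_self_nonneg (ξ : E) : 0 ≤ hinner M ξ ξ :=
  CStarModule.inner_self_nonneg (A := Mᵐᵒᵖ) (x := ξ)

lemma hinner_self_eq_zero {ξ : E} : hinner M ξ ξ = 0 ↔ ξ = 0 := by
  rw [hinner, MulOpposite.unop_eq_zero_iff, CStarModule.inner_self]

lemma hinner_add_left (ξ η ζ : E) : hinner M (ξ + η) ζ = hinner M ξ ζ + hinner M η ζ := by
  rw [← star_hinner, hinner_add_right, star_add, star_hinner, star_hinner]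

lemma hinner_smul_left (c : ℂ) (ξ η : E) : hinner M (c • ξ) η = star c • hinner M ξ η := by
  rw [← star_hinner, hinner_smul_right, star_smul, star_hinner]

lemma hinner_op_smul_left (a : M) (ξ η : E) : hinner M (op a • ξ) η = star a * hinner M ξ η := by
  rw [← star_hinner, hinner_op_smul_right, star_mul, star_hinner]

/-- The map `η ↦ ⟨ξ, η⟩`. -/
def hinnerRight (ξ : E) : E →ₗ[ℂ] M where
  toFun := hinner M ξ
  map_add' := hinner_add_right M ξ
  map_smul' c := hinner_smul_right M c ξ

/-- The map `ξ ↦ ⟨ξ, η⟩`. -/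
def hinnerLeft (η : E) : E →ₗ⋆[ℂ] M where
  toFun ξ := hinner M ξ η
  map_add' ξ ζ := hinner_add_left M ξ ζ η
  map_smul' c ξ := hinner_smul_left M c ξ η

lemma hinner_sum_right {ι : Type*} (s : Finset ι) (ξ : E) (η : ι → E) :
    hinner M ξ (∑ i ∈ s, η i) = ∑ i ∈ s, hinner M ξ (η i) :=
  map_sum (hinnerRight M ξ) _ _

lemma hinner_sum_left {ι : Type*} (s : Finset ι) (ξ : ι → E) (η : E) :
    hinner M (∑ i ∈ s, ξ i) η = ∑ i ∈ s, hinner M (ξ i) η :=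
  map_sum (hinnerLeft M η) _ _

lemma op_smul_zero (a : M) : op a • (0 : E) = 0 := by
  rw [← hinner_self_eq_zero M, hinner_op_smul_right]
  have h : hinner M (op a • (0 : E)) 0 = 0 := map_zero (hinnerRight M _)
  rw [h, zero_mul]

variable [StarOrderedRing M]

/-- A Gram matrix in a Hilbert module is a positive matrix: it has the form `Q⋆ Q`. -/
lemma exists_gram_eq {ι : Type} [Fintype ι] (ξ : ι → E) :
    ∃ Q : ι → ι → M, ∀ i j, hinner M (ξ i) (ξ j) = ∑ k, star (Q k i) * Q k j := by
  classical
  let G : CStarMatrix ι ι M := CStarMatrix.ofMatrix fun i j => hinner M (ξ i) (ξ j)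
  have hGa : ∀ i j, G i j = hinner M (ξ i) (ξ j) := fun i j => rfl
  have hG : IsSelfAdjoint G := by
    apply CStarMatrix.ext
    intro i j
    rw [CStarMatrix.star_apply, hGa, hGa, star_hinner]
  obtain ⟨b, R, hRR, hpos⟩ := exists_of_isSelfAdjoint hG
  have hdiag : ∀ l, ∑ i, star (R i l) * R i l = 0 := by
    intro l
    have e1 : ∑ i, star (R i l) * R i l = (star R * R) l l := by
      simp [CStarMatrix.mul_apply, CStarMatrix.star_apply]
    have e2 : (star b * (G * b)) l l =
        hinner M (∑ i, op (b i l) • ξ i) (∑ i, op (b i l) • ξ i) := by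
      rw [hinner_sum_left]
      simp only [hinner_sum_right, hinner_op_smul_right, hinner_op_smul_left,
        CStarMatrix.mul_apply, CStarMatrix.star_apply, Finset.mul_sum, hGa, mul_assoc]
    apply le_antisymm
    · rw [e1, hRR, CStarMatrix.neg_apply, e2, neg_nonpos]
      exact hinner_self_nonneg M _
    · exact Finset.sum_nonneg fun i _ => star_mul_self_nonneg _
  have hR : R = 0 := by
    apply CStarMatrix.ext
    intro i l
    have := (Finset.sum_eq_zero_iff_of_nonneg
      (fun i _ => star_mul_self_nonneg (R i l))).1 (hdiag l) i (Finset.mem_univ i)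
    exact (CStarRing.star_mul_self_eq_zero_iff _).1 this
  obtain ⟨Q, hQ⟩ := hpos hR
  refine ⟨fun i j => Q i j, fun i j => ?_⟩
  rw [← hGa, hQ]
  simp [CStarMatrix.mul_apply, CStarMatrix.star_apply]

end HilbertModule

/-! ## The interior tensor product with a Hilbert space -/

section InteriorTensor

variable {M : Type u} [NonUnitalCStarAlgebra M] [PartialOrder M] [StarOrderedRing M]
variable (E : Type v) [AddCommGroup E] [Module ℂ E] [SMul Mᵐᵒᵖ E] [Norm E] [CStarModule Mᵐᵒᵖ E]
variable {H : Type x} [NormedAddCommGroup H] [InnerProductSpace ℂ H] [CompleteSpace H]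

/-- The algebraic tensor product `E ⊗ H` over `ℂ`, to be given the semi-inner product
`⟨ξ ⊗ h, η ⊗ k⟩ = ⟨h, σ(⟨ξ, η⟩) k⟩`. -/
@[nolint unusedArguments]
def AlgTensor (_σ : M →⋆ₙₐ[ℂ] (H →L[ℂ] H)) : Type (max v x) := E ⊗[ℂ] H

variable (σ : M →⋆ₙₐ[ℂ] (H →L[ℂ] H))

instance : AddCommGroup (AlgTensor E σ) := inferInstanceAs (AddCommGroup (E ⊗[ℂ] H))
instance : Module ℂ (AlgTensor E σ) := inferInstanceAs (Module ℂ (E ⊗[ℂ] H))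

variable {E}

/-- The functional `η ⊗ k ↦ ⟨h, σ(⟨ξ, η⟩) k⟩`. -/
def tensorFormRight (ξ : E) (h : H) : E ⊗[ℂ] H →ₗ[ℂ] ℂ :=
  TensorProduct.lift <| LinearMap.mk₂ ℂ (fun η k => inner ℂ h (σ (hinner M ξ η) k))
    (fun η η' k => by simp [hinner_add_right])
    (fun c η k => by simp [hinner_smul_right])
    (fun η k k' => by simp)
    (fun c η k => by simp)

lemma tensorFormRight_tmul (ξ η : E) (h k : H) :
    tensorFormRight σ ξ h (η ⊗ₜ k) = inner ℂ h (σ (hinner M ξ η) k) := rfl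

/-- The sesquilinear form on `E ⊗ H` with
`⟨ξ ⊗ h, η ⊗ k⟩ = ⟨h, σ(⟨ξ, η⟩) k⟩`. -/
def tensorForm : E ⊗[ℂ] H →ₗ⋆[ℂ] E ⊗[ℂ] H →ₗ[ℂ] ℂ :=
  TensorProduct.lift <| LinearMap.mk₂'ₛₗ (starRingEnd ℂ) (starRingEnd ℂ)
    (fun ξ h => tensorFormRight σ ξ h)
    (fun ξ ξ' h => by
      ext η k; simp [tensorFormRight_tmul, hinner_add_left])
    (fun c ξ h => by
      ext η k; simp [tensorFormRight_tmul, hinner_smul_left])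
    (fun ξ h h' => by ext η k; simp [tensorFormRight_tmul])
    (fun c ξ h => by ext η k; simp [tensorFormRight_tmul, mul_comm])

lemma tensorForm_tmul (ξ η : E) (h k : H) :
    tensorForm σ (ξ ⊗ₜ h) (η ⊗ₜ k) = inner ℂ h (σ (hinner M ξ η) k) := rfl

lemma tensorForm_symm (s t : E ⊗[ℂ] H) : star (tensorForm σ s t) = tensorForm σ t s := by
  induction s with
  | zero => simp
  | add s s' hs hs' => simp [hs, hs']
  | tmul ξ h =>
    induction t with
    | zero => simp
    | add t t' ht ht' => simp [ht, ht']
    | tmul η k =>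
      rw [tensorForm_tmul, tensorForm_tmul, ← star_hinner M ξ η, map_star,
        ContinuousLinearMap.star_eq_adjoint, ContinuousLinearMap.adjoint_inner_right]
      exact inner_conj_symm _ _

lemma tensorForm_self_nonneg (s : E ⊗[ℂ] H) : 0 ≤ (tensorForm σ s s).re := by
  obtain ⟨n, ξ, h, rfl⟩ : ∃ (n : ℕ) (ξ : Fin n → E) (h : Fin n → H),
      s = ∑ i, ξ i ⊗ₜ[ℂ] h i := by
    obtain ⟨S, hS⟩ := TensorProduct.exists_multiset s
    obtain ⟨l, rfl⟩ := Quot.exists_rep S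
    refine ⟨l.length, fun i => (l.get i).1, fun i => (l.get i).2, ?_⟩
    rw [hS]
    change (Multiset.map _ (l : Multiset (E × H))).sum = _
    rw [Multiset.map_coe, Multiset.sum_coe, Fin.sum_univ_def]
    congr 1
    exact List.ext_get (by simp) (by simp)
  obtain ⟨Q, hQ⟩ := exists_gram_eq M ξ
  have key : tensorForm σ (∑ i, ξ i ⊗ₜ[ℂ] h i) (∑ i, ξ i ⊗ₜ[ℂ] h i) =
      ∑ k, inner ℂ (∑ i, σ (Q k i) (h i)) (∑ i, σ (Q k i) (h i)) := by
    have e : ∀ i j, tensorForm σ (ξ i ⊗ₜ[ℂ] h i) (ξ j ⊗ₜ[ℂ] h j) =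
        ∑ k, inner ℂ (σ (Q k i) (h i)) (σ (Q k j) (h j)) := by
      intro i j
      rw [tensorForm_tmul, hQ, map_sum, FunLike.coe_sum, Finset.sum_apply, inner_sum]
      refine Finset.sum_congr rfl fun k _ => ?_
      rw [map_mul, map_star, ContinuousLinearMap.star_eq_adjoint, ContinuousLinearMap.mul_def,
        ContinuousLinearMap.comp_apply, ContinuousLinearMap.adjoint_inner_right]
    simp only [map_sum, LinearMap.sum_apply, e, sum_inner, inner_sum]
    conv_lhs => enter [2, x]; rw [Finset.sum_comm]
    exact Finset.sum_comm
  rw [key, Complex.re_sum]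
  exact Finset.sum_nonneg fun k _ => inner_self_nonneg (𝕜 := ℂ)

/-- The semi-inner product on `E ⊗ H`. -/
@[reducible] def tensorCore : PreInnerProductSpace.Core ℂ (AlgTensor E σ) where
  inner s t := tensorForm σ s t
  conj_inner_symm s t := tensorForm_symm σ t s
  re_inner_nonneg s := tensorForm_self_nonneg σ s
  add_left s s' t := by
    exact LinearMap.congr_fun (map_add (tensorForm (E := E) σ) s s') t
  smul_left s t c := by
    exact LinearMap.congr_fun (map_smulₛₗ (tensorForm (E := E) σ) c s) t

instance : SeminormedAddCommGroup (AlgTensor E σ) :=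
  @InnerProductSpace.Core.toSeminormedAddCommGroup ℂ (AlgTensor E σ) _ _ _ (tensorCore σ)

instance : InnerProductSpace ℂ (AlgTensor E σ) := InnerProductSpace.ofCore (tensorCore σ)

variable (E)

/-- The interior tensor product `E ⊗_σ H`: the Hilbert space obtained from the algebraic tensor
product by separation and completion for the semi-inner product
`⟨ξ ⊗ h, η ⊗ k⟩ = ⟨h, σ(⟨ξ, η⟩) k⟩`. -/
abbrev InteriorTensor : Type (max v x) := UniformSpace.Completion (AlgTensor E σ)

/-- The canonical map of the algebraic tensor product into the interior tensor product. -/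
def toInterior : E ⊗[ℂ] H →ₗ[ℂ] InteriorTensor E σ :=
  (UniformSpace.Completion.toComplL (𝕜 := ℂ) (E := AlgTensor E σ)).toLinearMap

variable {E}

/-- The operator `A ⊗ I_H : E ⊗_σ H → F ⊗_σ H` induced by a linear map `A : E → F`: the continuous
extension of `ξ ⊗ h ↦ A ξ ⊗ h` (which is bounded for the operators to which it is applied below;
`extendOfNorm` is `0` for an unbounded map). -/
def ampliate {F : Type w} [AddCommGroup F] [Module ℂ F] [SMul Mᵐᵒᵖ F] [Norm F]
    [CStarModule Mᵐᵒᵖ F] (A : E →ₗ[ℂ] F) : InteriorTensor E σ →L[ℂ] InteriorTensor F σ :=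
  (toInterior F σ ∘ₗ TensorProduct.map A LinearMap.id).extendOfNorm (toInterior E σ)

/-- The operator `T̃ : E ⊗_σ H → H`, `T̃ (ξ ⊗ h) = T(ξ) h`, of a linear map `T : E → B(H)`: the
continuous extension of this map from the algebraic tensor product (it is a contraction when
`(T, σ)` is a completely contractive covariant representation). -/
def tilde (T : E →ₗ[ℂ] (H →L[ℂ] H)) : InteriorTensor E σ →L[ℂ] H :=
  (TensorProduct.lift (ContinuousLinearMap.coeLM ℂ ∘ₗ T)).extendOfNorm (toInterior E σ)

end InteriorTensor

/-! ## `A⋆`-algebras, `A⋆`-modules and `A⋆`-correspondences -/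

/-- The two settings: `C⋆`-algebras and `W⋆`-algebras. -/
inductive AStar
  | cstar
  | wstar

/-- In the `W⋆`-setting, `M` has to be a `W⋆`-algebra, that is, the dual of a Banach space. -/
def AStar.IsAlgebra (k : AStar) (M : Type u) [NonUnitalCStarAlgebra M] : Prop :=
  k = .wstar → ∃ (P : Type u) (_ : NormedAddCommGroup P) (_ : NormedSpace ℂ P)
    (_ : CompleteSpace P), Nonempty (StrongDual ℂ P ≃ₗᵢ⋆[ℂ] M)

/-- A representation of the `A⋆`-algebra `M` on a Hilbert space: a nondegenerate `*`-homomorphism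
`M → B(H)`, which is moreover normal (it preserves the suprema of increasing nets) in the
`W⋆`-setting. -/
def AStar.IsRep (k : AStar) {M : Type u} [NonUnitalCStarAlgebra M] [PartialOrder M] {H : Type x}
    [NormedAddCommGroup H] [InnerProductSpace ℂ H] [CompleteSpace H]
    (σ : M →⋆ₙₐ[ℂ] (H →L[ℂ] H)) : Prop :=
  Dense (Submodule.span ℂ {z : H | ∃ a h, z = σ a h} : Set H) ∧ (k = .wstar → ScottContinuous σ)

section Modules

variable (M : Type u) [NonUnitalCStarAlgebra M] [PartialOrder M]
variable {E : Type v} [NormedAddCommGroup E] [NormedSpace ℂ E] [SMul Mᵐᵒᵖ E] [CStarModule Mᵐᵒᵖ E]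

variable (E) in
/-- Every bounded `M`-module map `E → M` is of the form `⟨η, ·⟩`. -/
def SelfDual : Prop :=
  ∀ f : E →L[ℂ] M, (∀ ξ (a : M), f (op a • ξ) = f ξ * a) → ∃ η : E, ∀ ξ, f ξ = hinner M η ξ

/-- The notion of density that is used for tensor products of `A⋆`-correspondences: density in norm
in the `C⋆`-setting; in the `W⋆`-setting, density for the topology of the seminorms
`ξ ↦ ω(⟨ξ, ξ⟩)^(1/2)`, where `ω` is a normal positive functional on `M` (normality as stated here
contains positivity). A self-dual module in which a submodule is dense in this sense is the
self-dual extension of the submodule. -/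
def AStar.DenseIn (k : AStar) (N : Submodule ℂ E) : Prop :=
  match k with
  | .cstar => Dense (N : Set E)
  | .wstar => ∀ (ξ : E) (ω : M →ₗ[ℂ] ℂ), ScottContinuous ω → ∀ ε : ℝ, 0 < ε →
      ∃ η ∈ N, (ω (hinner M (ξ - η) (ξ - η))).re < ε

end Modules

/-- An `A⋆`-correspondence over `M`: a (complete, right) Hilbert `M`-module with a nondegenerate
left action of `M` by adjointable operators. In the `W⋆`-setting, the module is self-dual, and the
left action is normal. -/
structure Correspondence (k : AStar) (M : Type u) [NonUnitalCStarAlgebra M] [PartialOrder M] where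
  carrier : Type v
  [normedAddCommGroup : NormedAddCommGroup carrier]
  [normedSpace : NormedSpace ℂ carrier]
  [completeSpace : CompleteSpace carrier]
  [rightAction : SMul Mᵐᵒᵖ carrier]
  [cstarModule : CStarModule Mᵐᵒᵖ carrier]
  /-- the left action `a ξ = φ(a) ξ` -/
  lact : M →ₗ[ℂ] carrier →ₗ[ℂ] carrier
  lact_mul : ∀ a b ξ, lact (a * b) ξ = lact a (lact b ξ)
  hinner_lact : ∀ a ξ η, hinner M (lact a ξ) η = hinner M ξ (lact (star a) η)
  lact_nondegenerate : Dense (Submodule.span ℂ {ζ | ∃ a ξ, ζ = lact a ξ} : Set carrier)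
  selfDual : k = .wstar → SelfDual M carrier
  lact_normal : k = .wstar → ∀ ξ, ScottContinuous fun a => hinner M ξ (lact a ξ)

attribute [instance] Correspondence.normedAddCommGroup Correspondence.normedSpace
  Correspondence.completeSpace Correspondence.rightAction Correspondence.cstarModule

instance (k : AStar) (M : Type u) [NonUnitalCStarAlgebra M] [PartialOrder M] :
    CoeSort (Correspondence.{u, v} k M) (Type v) := ⟨Correspondence.carrier⟩

/-- The tensor product `E ⊗ F` of two `A⋆`-correspondences, which is determined up to a unique
isomorphism: an `A⋆`-correspondence that is generated by elementary tensors with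
`⟨ξ ⊗ η, ξ' ⊗ η'⟩ = ⟨η, ⟨ξ, ξ'⟩ η'⟩` and `a (ξ ⊗ η) = a ξ ⊗ η`. (The relations
`ξ a ⊗ η = ξ ⊗ a η` and `(ξ ⊗ η) a = ξ ⊗ η a` follow.) -/
structure CorrTensor {k : AStar} {M : Type u} [NonUnitalCStarAlgebra M] [PartialOrder M]
    (E F : Correspondence.{u, v} k M) where
  prod : Correspondence.{u, w} k M
  tmul : E →ₗ[ℂ] F →ₗ[ℂ] prod
  hinner_tmul : ∀ (ξ ξ' : E) (η η' : F),
    hinner M (tmul ξ η) (tmul ξ' η') = hinner M η (F.lact (hinner M ξ ξ') η')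
  lact_tmul : ∀ (a : M) (ξ : E) (η : F), prod.lact a (tmul ξ η) = tmul (E.lact a ξ) η
  dense_tmul : k.DenseIn M (Submodule.span ℂ {ζ : prod | ∃ ξ η, ζ = tmul ξ η})

/-! ## Subproduct systems -/

/-- A subproduct system `(X(n))` over the `A⋆`-algebra `M`. The equality `X(0) = M` is an
isomorphism `vac : M ≃ X(0)` of correspondences. The coisometries
`U_{n,m} : X(n) ⊗ X(m) → X(n+m)` are indexed by `n`, `m`, `p` with `n + m = p`.

The adjoint `Uadj` is an isometric bimodule map which embeds `X(n+m)` into `X(n) ⊗ X(m)` as an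
orthogonally complementable sub-bimodule, and `U` is the projection onto it. A standard subproduct
system is the case in which these embeddings are inclusions. -/
structure SubproductSystem (k : AStar) (M : Type u) [NonUnitalCStarAlgebra M]
    [PartialOrder M] where
  X : ℕ → Correspondence.{u, v} k M
  vac : M ≃ₗ[ℂ] X 0
  hinner_vac : ∀ a b, hinner M (vac a) (vac b) = star a * b
  vac_mul_right : ∀ a b, vac (a * b) = op b • vac a
  vac_mul_left : ∀ a b, vac (a * b) = (X 0).lact a (vac b)
  /-- the tensor products `X(n) ⊗ X(m)` -/
  tens : ∀ n m, CorrTensor.{u, v, w} (X n) (X m)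
  U : ∀ n m p : ℕ, n + m = p → ((tens n m).prod →ₗ[ℂ] X p)
  Uadj : ∀ n m p : ℕ, n + m = p → (X p →ₗ[ℂ] (tens n m).prod)
  hinner_U : ∀ n m p h ζ ξ, hinner M (U n m p h ζ) ξ = hinner M ζ (Uadj n m p h ξ)
  U_Uadj : ∀ n m p h ξ, U n m p h (Uadj n m p h ξ) = ξ
  U_lact : ∀ n m p h a ζ, U n m p h ((tens n m).prod.lact a ζ) = (X p).lact a (U n m p h ζ)
  U_right : ∀ n (ξ : X n) a, U n 0 n (add_zero n) ((tens n 0).tmul ξ (vac a)) = op a • ξ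
  U_left : ∀ n a (ξ : X n), U 0 n n (zero_add n) ((tens 0 n).tmul (vac a) ξ) = (X n).lact a ξ
  /-- `U_{n+m,l} (U_{n,m} ⊗ I) = U_{n,m+l} (I ⊗ U_{m,l})` -/
  U_assoc : ∀ (n m l nm ml p : ℕ) (hnm : n + m = nm) (hml : m + l = ml) (hp : nm + l = p)
    (hp' : n + ml = p) (ξ : X n) (η : X m) (ζ : X l),
    U nm l p hp ((tens nm l).tmul (U n m nm hnm ((tens n m).tmul ξ η)) ζ) =
      U n ml p hp' ((tens n ml).tmul ξ (U m l ml hml ((tens m l).tmul η ζ)))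

namespace SubproductSystem

variable {k : AStar} {M : Type u} [NonUnitalCStarAlgebra M] [PartialOrder M]
variable (𝒳 : SubproductSystem.{u, v, w} k M)

/-- The product `U_{n,m}(ξ ⊗ η)`. -/
def mul (n m : ℕ) (ξ : 𝒳.X n) : 𝒳.X m →ₗ[ℂ] 𝒳.X (n + m) :=
  𝒳.U n m (n + m) rfl ∘ₗ (𝒳.tens n m).tmul ξ

/-- The finite sequences in the Fock module `F_X = ⨁ X(n)`, with the `M`-valued inner product
`⟨ξ, η⟩ = ∑ ⟨ξ_n, η_n⟩`. Their completion is `F_X`. -/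
def Fock : Type v := ⨁ n, 𝒳.X n

instance : AddCommGroup 𝒳.Fock := inferInstanceAs (AddCommGroup (⨁ n, 𝒳.X n))
instance : Module ℂ 𝒳.Fock := inferInstanceAs (Module ℂ (⨁ n, 𝒳.X n))

variable {𝒳} in
/-- The coordinate `ξ_n ∈ X(n)` of a finite sequence `ξ`. -/
def coord (n : ℕ) : 𝒳.Fock →ₗ[ℂ] 𝒳.X n := DirectSum.component ℂ ℕ (fun n => 𝒳.X n) n

variable {𝒳} in
lemma ext_coord {ξ η : 𝒳.Fock} (h : ∀ n, coord n ξ = coord n η) : ξ = η := DFinsupp.ext h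

variable {𝒳} in
lemma exists_support (ξ : 𝒳.Fock) : ∃ s : Finset ℕ, ∀ n ∉ s, coord n ξ = 0 := by
  classical
  exact ⟨DFinsupp.support (β := fun n => 𝒳.X n) ξ,
    fun n hn => DFinsupp.notMem_support_iff (β := fun n => 𝒳.X n).1 hn⟩

instance : SMul Mᵐᵒᵖ 𝒳.Fock where
  smul a ξ := DFinsupp.mapRange (β₁ := fun n => 𝒳.X n) (β₂ := fun n => 𝒳.X n)
    (fun _ ζ => a • ζ) (fun _ => op_smul_zero M (unop a)) ξ

lemma coord_smul (a : Mᵐᵒᵖ) (ξ : 𝒳.Fock) (n : ℕ) : coord n (a • ξ) = a • coord n ξ :=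
  rfl

/-- The inner product `∑ ⟨ξ_n, η_n⟩` of finite sequences. -/
def fockInner (ξ η : 𝒳.Fock) : M := ∑ᶠ n, hinner M (coord n ξ) (coord n η)

lemma fockInner_eq (ξ η : 𝒳.Fock) {s : Finset ℕ} (hs : ∀ n ∉ s, coord n η = 0) :
    𝒳.fockInner ξ η = ∑ n ∈ s, hinner M (coord n ξ) (coord n η) := by
  refine finsum_eq_sum_of_support_subset _ fun n hn => ?_
  by_contra h
  refine hn ?_
  change hinnerRight M (coord n ξ) (coord n η) = 0
  rw [hs n h, map_zero]

instance : Norm 𝒳.Fock where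
  norm ξ := √‖𝒳.fockInner ξ ξ‖

instance [StarOrderedRing M] : CStarModule Mᵐᵒᵖ 𝒳.Fock where
  inner ξ η := op (𝒳.fockInner ξ η)
  inner_add_right {ξ η ζ} := by
    obtain ⟨s, hs⟩ := exists_support η
    obtain ⟨t, ht⟩ := exists_support ζ
    have hs' : ∀ n ∉ s ∪ t, coord n η = 0 := fun n hn => hs n (by grind)
    have ht' : ∀ n ∉ s ∪ t, coord n ζ = 0 := fun n hn => ht n (by grind)
    have hst : ∀ n ∉ s ∪ t, coord n (η + ζ) = 0 := fun n hn => by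
      rw [map_add, hs' n hn, ht' n hn, add_zero]
    rw [𝒳.fockInner_eq ξ _ hs', 𝒳.fockInner_eq ξ _ ht', 𝒳.fockInner_eq ξ _ hst,
      ← MulOpposite.op_add, ← Finset.sum_add_distrib]
    simp only [map_add, hinner_add_right]
  inner_self_nonneg {ξ} := by
    obtain ⟨s, hs⟩ := exists_support ξ
    rw [𝒳.fockInner_eq ξ ξ hs]
    exact MulOpposite.op_nonneg.2 (Finset.sum_nonneg fun n _ => hinner_self_nonneg M _)
  inner_self {ξ} := by
    obtain ⟨s, hs⟩ := exists_support ξ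
    rw [MulOpposite.op_eq_zero_iff, 𝒳.fockInner_eq ξ ξ hs,
      Finset.sum_eq_zero_iff_of_nonneg fun n _ => hinner_self_nonneg M _]
    constructor
    · intro h
      apply ext_coord
      intro n
      rw [map_zero]
      by_cases hn : n ∈ s
      · exact (hinner_self_eq_zero M).1 (h n hn)
      · exact hs n hn
    · rintro rfl n -
      rw [map_zero, hinner_self_eq_zero]
  inner_op_smul_right {a ξ η} := by
    obtain ⟨s, hs⟩ := exists_support η
    have hs' : ∀ n ∉ s, coord n (a • η) = 0 := fun n hn => by
      rw [coord_smul, hs n hn]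
      exact op_smul_zero M (unop a)
    rw [𝒳.fockInner_eq ξ η hs, 𝒳.fockInner_eq ξ _ hs']
    apply MulOpposite.unop_injective
    change _ = (∑ n ∈ s, hinner M (coord n ξ) (coord n η)) * unop a
    rw [Finset.sum_mul, MulOpposite.unop_op]
    refine Finset.sum_congr rfl fun n _ => ?_
    rw [coord_smul]
    exact hinner_op_smul_right M (unop a) _ _
  inner_smul_right_complex {c ξ η} := by
    obtain ⟨s, hs⟩ := exists_support η
    have hs' : ∀ n ∉ s, coord n (c • η) = 0 := fun n hn => by rw [map_smul, hs n hn, smul_zero]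
    rw [𝒳.fockInner_eq ξ η hs, 𝒳.fockInner_eq ξ _ hs', ← MulOpposite.op_smul, Finset.smul_sum]
    simp only [map_smul, hinner_smul_right]
  star_inner ξ η := by
    obtain ⟨s, hs⟩ := exists_support η
    obtain ⟨t, ht⟩ := exists_support ξ
    have hs' : ∀ n ∉ s ∪ t, coord n η = 0 := fun n hn => hs n (by grind)
    have ht' : ∀ n ∉ s ∪ t, coord n ξ = 0 := fun n hn => ht n (by grind)
    rw [𝒳.fockInner_eq ξ _ hs', 𝒳.fockInner_eq η _ ht', ← MulOpposite.op_star, star_sum]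
    simp only [star_hinner]
  norm_eq_sqrt_norm_inner_self ξ := rfl

/-- The creation operator `S_n(ζ)`, `S_n(ζ) η = U_{n,m}(ζ ⊗ η)` for `η ∈ X(m)`. -/
def shift (n : ℕ) (ζ : 𝒳.X n) : 𝒳.Fock →ₗ[ℂ] 𝒳.Fock :=
  DirectSum.toModule ℂ ℕ (⨁ m, 𝒳.X m)
    fun m => DirectSum.lof ℂ ℕ (fun m => 𝒳.X m) (n + m) ∘ₗ 𝒳.mul n m ζ

section

variable [StarOrderedRing M] {D : Type x} [NormedAddCommGroup D] [InnerProductSpace ℂ D]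
  [CompleteSpace D]

/-- The Hilbert space `F_X ⊗_π D`. -/
abbrev FockTensor (π : M →⋆ₙₐ[ℂ] (D →L[ℂ] D)) : Type (max v x) := InteriorTensor 𝒳.Fock π

/-- The operator `S_n(ζ) ⊗ I_D` on `F_X ⊗_π D`. -/
def shiftTensor (π : M →⋆ₙₐ[ℂ] (D →L[ℂ] D)) (n : ℕ) (ζ : 𝒳.X n) :
    𝒳.FockTensor π →L[ℂ] 𝒳.FockTensor π :=
  ampliate π (𝒳.shift n ζ)

end

end SubproductSystem

/-! ## Completely contractive covariant representations -/

section Representation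

variable {k : AStar} {M : Type u} [NonUnitalCStarAlgebra M] [PartialOrder M] [StarOrderedRing M]

/-- Complete contractivity of a linear map `T : E → B(H)` on a Hilbert module: for every matrix
`(ξ_{ij})` over `E`, the norm of `(T(ξ_{ij}))` in `M_n(B(H))` is at most the norm of `(ξ_{ij})` in
`M_n(E)`, whose square is the norm of the matrix `(∑_l ⟨ξ_{li}, ξ_{lj}⟩)` in `M_n(M)`. -/
def CompletelyContractive (M : Type u) [NonUnitalCStarAlgebra M] [PartialOrder M]
    [StarOrderedRing M] {E : Type v} [AddCommGroup E] [Module ℂ E] [SMul Mᵐᵒᵖ E] [Norm E]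
    [CStarModule Mᵐᵒᵖ E] {H : Type x} [NormedAddCommGroup H] [InnerProductSpace ℂ H]
    [CompleteSpace H] (T : E →ₗ[ℂ] (H →L[ℂ] H)) : Prop :=
  ∀ (n : ℕ) (ξ : Fin n → Fin n → E),
    ‖(CStarMatrix.ofMatrix fun i j => T (ξ i j) : CStarMatrix (Fin n) (Fin n) (H →L[ℂ] H))‖ ≤
      √‖(CStarMatrix.ofMatrix fun i j => ∑ l, hinner M (ξ l i) (ξ l j) :
        CStarMatrix (Fin n) (Fin n) M)‖

/-- A completely contractive covariant representation `T = (T_n)` of the subproduct system `𝒳` on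
the Hilbert space `H`, with `σ = T_0`. (In the `W⋆`-setting, `σ` is normal; the continuity of `T_n`
for the `σ`-topology and the ultraweak topology is then automatic.) -/
structure Rep (𝒳 : SubproductSystem.{u, v, w} k M) (H : Type x) [NormedAddCommGroup H]
    [InnerProductSpace ℂ H] [CompleteSpace H] where
  T : ∀ n, 𝒳.X n →ₗ[ℂ] (H →L[ℂ] H)
  σ : M →⋆ₙₐ[ℂ] (H →L[ℂ] H)
  T_zero : ∀ a, T 0 (𝒳.vac a) = σ a
  isRep : k.IsRep σ
  T_left : ∀ n a ξ, T n ((𝒳.X n).lact a ξ) = σ a * T n ξ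
  T_right : ∀ n ξ a, T n (op a • ξ) = T n ξ * σ a
  completelyContractive : ∀ n, CompletelyContractive M (T n)
  T_mul : ∀ n m ξ η, T (n + m) (𝒳.mul n m ξ η) = T n ξ * T m η

namespace Rep

variable {𝒳 : SubproductSystem.{u, v, w} k M} {H : Type x} [NormedAddCommGroup H]
  [InnerProductSpace ℂ H] [CompleteSpace H] (T : Rep 𝒳 H)

/-- `T̃_n : X(n) ⊗_σ H → H`. -/
def tilde (n : ℕ) : InteriorTensor (𝒳.X n) T.σ →L[ℂ] H := CovariantRep.tilde T.σ (T.T n)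

/-- `T` is pure: `T̃_n T̃_n⋆ → 0` in the strong operator topology. -/
def IsPure : Prop :=
  ∀ h : H, Filter.Tendsto (fun n => (T.tilde n ∘L ContinuousLinearMap.adjoint (T.tilde n)) h)
    Filter.atTop (𝓝 0)

/-- `S` is invariant for `T`: it is invariant for `σ(M)` and for all `T_n(ζ)` with `n ≥ 1`. -/
def IsInvariant (S : ClosedSubmodule ℂ H) : Prop :=
  (∀ a, ∀ h ∈ S, T.σ a h ∈ S) ∧ ∀ n, 1 ≤ n → ∀ ζ : 𝒳.X n, ∀ h ∈ S, T.T n ζ h ∈ S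

end Rep

end Representation

end CovariantRep

end

set_option linter.unusedSectionVars false

noncomputable section

namespace CovariantRep

open ContinuousLinearMap (adjoint)
open Filter

/-! ## Operators on interior tensor products -/

section Interior

variable {M : Type u} [NonUnitalCStarAlgebra M] [PartialOrder M] [StarOrderedRing M]
variable {E : Type*} [AddCommGroup E] [Module ℂ E] [SMul Mᵐᵒᵖ E] [Norm E] [CStarModule Mᵐᵒᵖ E]
variable {F : Type*} [AddCommGroup F] [Module ℂ F] [SMul Mᵐᵒᵖ F] [Norm F] [CStarModule Mᵐᵒᵖ F]
variable {H : Type*} [NormedAddCommGroup H] [InnerProductSpace ℂ H] [CompleteSpace H]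
variable {K : Type*} [NormedAddCommGroup K] [InnerProductSpace ℂ K] [CompleteSpace K]
variable (σ : M →⋆ₙₐ[ℂ] (H →L[ℂ] H)) (τ : M →⋆ₙₐ[ℂ] (K →L[ℂ] K))

/-! One direction is formal. If P_S = ΦΦ⋆, then Φ maps into S (`mem_of_starProjection_eq`), and
every h ∈ S equals ΦΦ⋆h, so T_n(ζ)h = Φ(S_n(ζ) ⊗ I)Φ⋆h lies in S.

For the converse, Φ is a Poisson transform of T compressed to S. Put Q = P_S and Y_n(ξ ⊗ h) =
T_n(ξ)Qh (`cut`). Invariance gives QY_n = Y_n, and in degree zero it makes Q commute with σ(M), so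
Y_n = T̃_n(I ⊗ Q) is a contraction. Multiplicativity of T reads Y_{n+1}(U_{n,1} ⊗ I) = Y_n(I ⊗ Y_1).
As U_{n,1} and the associativity map are coisometric, Y_{n+1}Y_{n+1}⋆ = Y_n(I ⊗ Y_1Y_1⋆)Y_n⋆
(`cut_succ_comp_adjoint`). Let Δ be the square root of Q − Y_1Y_1⋆ ≥ 0; it commutes with σ(M). Then
L_n = Y_n(I ⊗ Δ) satisfies L_nL_n⋆ = Y_nY_n⋆ − Y_{n+1}Y_{n+1}⋆ (`poissonComponent_comp_adjoint`).
The sums telescope from Y_0Y_0⋆ = Q to Q − Y_NY_N⋆, and purity removes the remainder. Hence the row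
Φ = (L_0, L_1, …) on F_X ⊗_σ H is a contraction with ΦΦ⋆ = Q, and multiplicativity of T makes it
intertwine the creation operators with T.

Two points need analysis. That T̃_n is a contraction is deduced from complete contractivity by an
approximate polar decomposition of Gram matrices (`norm_lift_le`). And in the W⋆-setting elementary
tensors are dense only in a weak sense; this suffices after tensoring with H because vector
functionals of a normal representation are normal (`scottContinuous_inner_apply`,
`denseRange_assocTensor`). -/

lemma inner_toInterior (s t : E ⊗[ℂ] H) :
    inner ℂ (toInterior E σ s) (toInterior E σ t) = tensorForm σ s t :=
  UniformSpace.Completion.inner_coe (𝕜 := ℂ) (E := AlgTensor E σ) _ _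

lemma inner_toInterior_tmul (ξ η : E) (h k : H) :
    inner ℂ (toInterior E σ (ξ ⊗ₜ h)) (toInterior E σ (η ⊗ₜ k)) =
      inner ℂ h (σ (hinner M ξ η) k) :=
  inner_toInterior σ _ _

lemma denseRange_toInterior : DenseRange (toInterior E σ) :=
  UniformSpace.Completion.denseRange_coe (α := AlgTensor E σ)

lemma norm_sq_toInterior (t : E ⊗[ℂ] H) :
    ‖toInterior E σ t‖ ^ 2 = (tensorForm σ t t).re := by
  rw [← inner_toInterior, ← inner_self_eq_norm_sq (𝕜 := ℂ)]; rfl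

variable {σ τ} in
lemma interior_ext {G : Type*} [TopologicalSpace G] [AddCommGroup G] [Module ℂ G] [T2Space G]
    {A B : InteriorTensor E σ →L[ℂ] G}
    (h : ∀ ξ h, A (toInterior E σ (ξ ⊗ₜ h)) = B (toInterior E σ (ξ ⊗ₜ h))) : A = B := by
  have : A.toLinearMap ∘ₗ toInterior E σ = B.toLinearMap ∘ₗ toInterior E σ :=
    TensorProduct.ext' h
  refine ContinuousLinearMap.ext fun z => ?_
  refine congrFun ((denseRange_toInterior σ).equalizer A.continuous B.continuous ?_) z
  exact funext fun t => LinearMap.congr_fun this t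

/-- An unbounded map gets the default value 0 from `extendOfNorm`, so each operator on an interior
tensor product needs such a bound before it can be evaluated on elementary tensors. -/
lemma extendOfNorm_toInterior {f : E ⊗[ℂ] H →ₗ[ℂ] K} {C : ℝ}
    (hf : ∀ t, ‖f t‖ ≤ C * ‖toInterior E σ t‖) (t : E ⊗[ℂ] H) :
    f.extendOfNorm (toInterior E σ) (toInterior E σ t) = f t :=
  LinearMap.extendOfNorm_eq (denseRange_toInterior σ) ⟨C, hf⟩ t

lemma opNorm_extendOfNorm_toInterior {f : E ⊗[ℂ] H →ₗ[ℂ] K} {C : ℝ} (hC : 0 ≤ C)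
    (hf : ∀ t, ‖f t‖ ≤ C * ‖toInterior E σ t‖) :
    ‖f.extendOfNorm (toInterior E σ)‖ ≤ C :=
  LinearMap.opNorm_extendOfNorm_le (denseRange_toInterior σ) hC hf

lemma exists_fin_sum_tmul (s : E ⊗[ℂ] H) : ∃ (n : ℕ) (ξ : Fin n → E) (h : Fin n → H),
    s = ∑ i, ξ i ⊗ₜ[ℂ] h i := by
  obtain ⟨S, hS⟩ := TensorProduct.exists_multiset s
  obtain ⟨l, rfl⟩ := Quot.exists_rep S
  refine ⟨l.length, fun i => (l.get i).1, fun i => (l.get i).2, ?_⟩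
  rw [hS]
  change (Multiset.map _ (l : Multiset (E × H))).sum = _
  rw [Multiset.map_coe, Multiset.sum_coe, Fin.sum_univ_def]
  congr 1
  exact List.ext_get (by simp) (by simp)

/-- The semi-norm of a sum of elementary tensors in terms of a factorization of the Gram matrix. -/
lemma tensorForm_sum_eq {n : ℕ} (ξ : Fin n → E) (h : Fin n → H) {Q : Fin n → Fin n → M}
    (hQ : ∀ i j, hinner M (ξ i) (ξ j) = ∑ k, star (Q k i) * Q k j) :
    ‖toInterior E σ (∑ i, ξ i ⊗ₜ[ℂ] h i)‖ ^ 2 = ∑ k, ‖∑ i, σ (Q k i) (h i)‖ ^ 2 := by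
  have key : tensorForm σ (∑ i, ξ i ⊗ₜ[ℂ] h i) (∑ i, ξ i ⊗ₜ[ℂ] h i) =
      ∑ k, inner ℂ (∑ i, σ (Q k i) (h i)) (∑ i, σ (Q k i) (h i)) := by
    have e : ∀ i j, tensorForm σ (ξ i ⊗ₜ[ℂ] h i) (ξ j ⊗ₜ[ℂ] h j) =
        ∑ k, inner ℂ (σ (Q k i) (h i)) (σ (Q k j) (h j)) := by
      intro i j
      rw [tensorForm_tmul, hQ, map_sum, FunLike.coe_sum, Finset.sum_apply, inner_sum]
      refine Finset.sum_congr rfl fun k _ => ?_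
      rw [map_mul, map_star, ContinuousLinearMap.star_eq_adjoint, ContinuousLinearMap.mul_def,
        ContinuousLinearMap.comp_apply, ContinuousLinearMap.adjoint_inner_right]
    simp only [map_sum, LinearMap.sum_apply, e, sum_inner, inner_sum]
    conv_lhs => enter [2, x]; rw [Finset.sum_comm]
    exact Finset.sum_comm
  rw [norm_sq_toInterior, key, Complex.re_sum]
  exact Finset.sum_congr rfl fun k _ => inner_self_eq_norm_sq (𝕜 := ℂ) _

variable {σ τ} in
/-- The operator `I ⊗ C` is bounded by `‖C‖` for an intertwiner `C`. -/
lemma norm_map_id_le {C : H →L[ℂ] K} (hC : ∀ a h, C (σ a h) = τ a (C h)) (t : E ⊗[ℂ] H) :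
    ‖toInterior E τ (TensorProduct.map LinearMap.id C.toLinearMap t)‖ ≤
      ‖C‖ * ‖toInterior E σ t‖ := by
  obtain ⟨n, ξ, h, rfl⟩ := exists_fin_sum_tmul t
  obtain ⟨Q, hQ⟩ := exists_gram_eq M ξ
  refine le_of_sq_le_sq ?_ (by positivity)
  have e : TensorProduct.map LinearMap.id C.toLinearMap (∑ i, ξ i ⊗ₜ[ℂ] h i) =
      ∑ i, ξ i ⊗ₜ[ℂ] C (h i) := by simp
  rw [e, mul_pow, tensorForm_sum_eq σ ξ h hQ, tensorForm_sum_eq τ ξ _ hQ, Finset.mul_sum]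
  refine Finset.sum_le_sum fun k _ => ?_
  -- Intertwining pulls C out of ∑ τ(Q_ki) C h_i, so the bound holds summand by summand in k.
  simp only [← hC, ← map_sum]
  rw [← mul_pow]
  gcongr
  exact C.le_opNorm _

variable (E) in
/-- The operator `I ⊗ C : E ⊗_σ H → E ⊗_τ K`, for an intertwiner `C : H → K`. -/
def idTensor (C : H →L[ℂ] K) : InteriorTensor E σ →L[ℂ] InteriorTensor E τ :=
  (toInterior E τ ∘ₗ TensorProduct.map LinearMap.id C.toLinearMap).extendOfNorm (toInterior E σ)

variable {σ τ} in
lemma idTensor_tmul {C : H →L[ℂ] K} (hC : ∀ a h, C (σ a h) = τ a (C h)) (ξ : E) (h : H) :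
    idTensor E σ τ C (toInterior E σ (ξ ⊗ₜ h)) = toInterior E τ (ξ ⊗ₜ C h) :=
  extendOfNorm_toInterior σ (norm_map_id_le hC) _

variable {σ τ} in
lemma norm_idTensor_le {C : H →L[ℂ] K} (hC : ∀ a h, C (σ a h) = τ a (C h)) :
    ‖idTensor E σ τ C‖ ≤ ‖C‖ :=
  opNorm_extendOfNorm_toInterior σ (norm_nonneg C) (norm_map_id_le hC)

variable {σ τ} in
lemma intertwine_adjoint {C : H →L[ℂ] K} (hC : ∀ a h, C (σ a h) = τ a (C h)) (a : M) (k : K) :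
    adjoint C (τ a k) = σ a (adjoint C k) := by
  refine ext_inner_right ℂ fun h => ?_
  have e1 : σ a = adjoint (σ (star a)) := by
    rw [map_star, ContinuousLinearMap.star_eq_adjoint, ContinuousLinearMap.adjoint_adjoint]
  have e2 : τ a = adjoint (τ (star a)) := by
    rw [map_star, ContinuousLinearMap.star_eq_adjoint, ContinuousLinearMap.adjoint_adjoint]
  rw [e1, e2]
  simp only [ContinuousLinearMap.adjoint_inner_left, hC]

variable {σ τ} in
/-- Two operators are adjoint if they are formally adjoint on elementary tensors. -/
lemma adjoint_eq_of_tmul {A : InteriorTensor E σ →L[ℂ] InteriorTensor F τ}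
    {B : InteriorTensor F τ →L[ℂ] InteriorTensor E σ}
    (h : ∀ ξ h η k, inner ℂ (A (toInterior E σ (ξ ⊗ₜ h))) (toInterior F τ (η ⊗ₜ k)) =
      inner ℂ (toInterior E σ (ξ ⊗ₜ h)) (B (toInterior F τ (η ⊗ₜ k)))) : adjoint A = B := by
  refine interior_ext fun η k => ?_
  refine ext_inner_left ℂ fun z => ?_
  rw [ContinuousLinearMap.adjoint_inner_right]
  -- Density has been used in the second variable; with η ⊗ k fixed, it is now used in the first.
  have : (innerSL ℂ (toInterior F τ (η ⊗ₜ k)) ∘L A) =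
      innerSL ℂ (B (toInterior F τ (η ⊗ₜ k))) := by
    refine interior_ext fun ξ h' => ?_
    simp only [ContinuousLinearMap.comp_apply, innerSL_apply_apply]
    rw [← inner_conj_symm, h, inner_conj_symm]
  have := DFunLike.congr_fun this z
  simp only [ContinuousLinearMap.comp_apply, innerSL_apply_apply] at this
  rw [← inner_conj_symm, this, inner_conj_symm]

variable {σ τ} in
lemma adjoint_idTensor {C : H →L[ℂ] K} (hC : ∀ a h, C (σ a h) = τ a (C h)) :
    adjoint (idTensor E σ τ C) = idTensor E τ σ (adjoint C) := by
  refine adjoint_eq_of_tmul fun ξ h η k => ?_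
  rw [idTensor_tmul hC, idTensor_tmul (intertwine_adjoint hC), inner_toInterior_tmul,
    inner_toInterior_tmul, ← intertwine_adjoint hC, ContinuousLinearMap.adjoint_inner_right]

/-- A linear map `L : E → B(H, K)` with `L(ξ)⋆ L(η) = σ(⟨ξ, η⟩)` defines an isometry. -/
lemma norm_lift_eq {L : E →ₗ[ℂ] (H →L[ℂ] K)}
    (hL : ∀ ξ η h k, inner ℂ (L ξ h) (L η k) = inner ℂ h (σ (hinner M ξ η) k)) (t : E ⊗[ℂ] H) :
    ‖TensorProduct.lift (ContinuousLinearMap.coeLM ℂ ∘ₗ L) t‖ = ‖toInterior E σ t‖ := by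
  have key : ∀ s t, inner ℂ (TensorProduct.lift (ContinuousLinearMap.coeLM ℂ ∘ₗ L) s)
      (TensorProduct.lift (ContinuousLinearMap.coeLM ℂ ∘ₗ L) t) = tensorForm σ s t := by
    intro s t
    induction s with
    | zero => simp
    | add s s' hs hs' => simp only [map_add, inner_add_left, hs, hs', LinearMap.add_apply]
    | tmul ξ h =>
      induction t with
      | zero => simp
      | add t t' ht ht' => simp only [map_add, inner_add_right, ht, ht']
      | tmul η k => exact hL ξ η h k
  rw [← sq_eq_sq₀ (norm_nonneg _) (norm_nonneg _), norm_sq_toInterior, ← key,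
    ← inner_self_eq_norm_sq (𝕜 := ℂ)]
  rfl

/-- The operator `ξ ⊗ h ↦ L(ξ) h`. -/
def liftTensor (L : E →ₗ[ℂ] (H →L[ℂ] K)) : InteriorTensor E σ →L[ℂ] K :=
  (TensorProduct.lift (ContinuousLinearMap.coeLM ℂ ∘ₗ L)).extendOfNorm (toInterior E σ)

lemma liftTensor_tmul {L : E →ₗ[ℂ] (H →L[ℂ] K)}
    (hL : ∀ ξ η h k, inner ℂ (L ξ h) (L η k) = inner ℂ h (σ (hinner M ξ η) k)) (ξ : E) (h : H) :
    liftTensor σ L (toInterior E σ (ξ ⊗ₜ h)) = L ξ h :=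
  extendOfNorm_toInterior σ (C := 1) (fun t => by rw [one_mul, norm_lift_eq σ hL]) _

lemma norm_liftTensor {L : E →ₗ[ℂ] (H →L[ℂ] K)}
    (hL : ∀ ξ η h k, inner ℂ (L ξ h) (L η k) = inner ℂ h (σ (hinner M ξ η) k))
    (z : InteriorTensor E σ) : ‖liftTensor σ L z‖ = ‖z‖ := by
  refine congrFun ((denseRange_toInterior σ).equalizer
    (liftTensor σ L).continuous.norm continuous_norm ?_) z
  refine funext fun t => ?_
  simp only [Function.comp_apply]
  rw [← norm_lift_eq σ hL]
  congr 1
  exact extendOfNorm_toInterior σ (C := 1) (fun t => by rw [one_mul, norm_lift_eq σ hL]) _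

lemma norm_toInterior_tmul_le (ξ : E) (h : H) :
    ‖toInterior E σ (ξ ⊗ₜ h)‖ ≤ √‖hinner M ξ ξ‖ * ‖h‖ := by
  refine le_of_sq_le_sq ?_ (by positivity)
  rw [norm_sq_toInterior, tensorForm_tmul, mul_pow, Real.sq_sqrt (norm_nonneg _)]
  refine (Complex.re_le_norm _).trans ((norm_inner_le_norm _ _).trans ?_)
  have h1 : ‖σ (hinner M ξ ξ) h‖ ≤ ‖hinner M ξ ξ‖ * ‖h‖ :=
    (ContinuousLinearMap.le_opNorm _ _).trans
      (mul_le_mul_of_nonneg_right (NonUnitalStarAlgHom.norm_apply_le σ _) (norm_nonneg _))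
  nlinarith [norm_nonneg h]

lemma inner_map_of_norm_map {A : H →L[ℂ] K} (hA : ∀ h, ‖A h‖ = ‖h‖) (h k : H) :
    inner ℂ (A h) (A k) = inner ℂ h k :=
  LinearIsometry.inner_map_map (⟨A.toLinearMap, hA⟩ : H →ₗᵢ[ℂ] K) h k

/-- An isometry with dense range is a coisometry. -/
lemma comp_adjoint_of_isometry_of_denseRange {A : H →L[ℂ] K} (hA : ∀ h, ‖A h‖ = ‖h‖)
    (hd : DenseRange A) : A ∘L adjoint A = ContinuousLinearMap.id ℂ K := by
  refine ContinuousLinearMap.ext fun z => ?_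
  refine congrFun (hd.equalizer (A ∘L adjoint A).continuous continuous_id ?_) z
  refine funext fun h => ?_
  simp only [Function.comp_apply, id, ContinuousLinearMap.comp_apply]
  congr 1
  refine ext_inner_left ℂ fun k => ?_
  rw [ContinuousLinearMap.adjoint_inner_right, inner_map_of_norm_map hA]

end Interior

/-! ## Functional calculus -/

section CStar

variable {A : Type*} [NonUnitalCStarAlgebra A]

/-- In the unitization, `1 - a⋆ a = (1 - c)²` for a contraction `a`. -/
lemma exists_one_sub_sq {a : A} (ha : ‖a‖ ≤ 1) :
    ∃ c : A, star c = c ∧ star a * a = c + c - c * c := by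
  let : PartialOrder A := CStarAlgebra.spectralOrder A
  have : StarOrderedRing A := CStarAlgebra.spectralOrderedRing A
  have hp : 0 ≤ star a * a := star_mul_self_nonneg a
  have hs : IsSelfAdjoint (star a * a) := hp.isSelfAdjoint
  have hn : ‖star a * a‖ ≤ 1 := by
    rw [CStarRing.norm_star_mul_self]; nlinarith [norm_nonneg a]
  have hle : ∀ t ∈ quasispectrum ℝ (star a * a), t ≤ 1 := fun t ht => by
    have := norm_apply_le_norm_cfcₙ (id : ℝ → ℝ) (star a * a) ht
    rw [cfcₙ_id ℝ (star a * a)] at this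
    exact (le_abs_self t).trans (this.trans hn)
  -- c = 1 − √(1 − a⋆a); the function vanishes at 0, so c lies in the algebra itself and not only in
  -- its unitization.
  have hf : Continuous fun t : ℝ => 1 - √(1 - t) := by fun_prop
  have hf0 : (fun t : ℝ => 1 - √(1 - t)) 0 = 0 := by simp
  refine ⟨cfcₙ (fun t : ℝ => 1 - √(1 - t)) (star a * a),
    (cfcₙ_predicate (p := IsSelfAdjoint) _ _).star_eq, ?_⟩
  rw [← cfcₙ_add _ _ _ hf.continuousOn hf0 hf.continuousOn hf0,
    ← cfcₙ_mul _ _ _ hf.continuousOn hf0 hf.continuousOn hf0,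
    ← cfcₙ_sub _ _ _ (by fun_prop) (by simp) (by fun_prop) (by simp)]
  nth_rewrite 1 [← cfcₙ_id ℝ (star a * a)]
  refine cfcₙ_congr fun t ht => ?_
  have := Real.sq_sqrt (sub_nonneg.2 (hle t ht))
  simp only [id]
  linarith

/-- An approximate polar decomposition of a positive element `G = b²`: `a ≈ G^(-1/2)`. -/
lemma exists_approx_inv_sqrt (q : A) {ε : ℝ} (hε : 0 < ε) :
    ∃ a b : A, star a = a ∧ star b = b ∧ b * b = star q * q ∧ ‖a * (star q * q) * a‖ ≤ 1 ∧
      ‖star q * q - star q * q * (a * b) - star (a * b) * (star q * q) +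
        star (a * b) * (star q * q) * (a * b)‖ ≤ ε := by
  let : PartialOrder A := CStarAlgebra.spectralOrder A
  have : StarOrderedRing A := CStarAlgebra.spectralOrderedRing A
  set G := star q * q
  have hp : 0 ≤ G := star_mul_self_nonneg q
  have hs : IsSelfAdjoint G := hp.isSelfAdjoint
  have hge : ∀ t ∈ quasispectrum ℝ G, 0 ≤ t := fun t ht => quasispectrum_nonneg_of_nonneg G hp t ht
  have hne : ∀ t : ℝ, |t| + ε ≠ 0 := fun t => by positivity
  -- On the spectrum f(t) = √t/(t + ε) approximates t^(-1/2). The absolute value makes f continuous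
  -- on all of ℝ. Then aGa corresponds to t²/(t + ε)² ≤ 1, and the remainder to t(1 − fg)² = tε²/(t
  -- + ε)² ≤ ε.
  let f : ℝ → ℝ := fun t => √t / (|t| + ε)
  let g : ℝ → ℝ := fun t => √t
  have hf : Continuous f := by fun_prop (disch := assumption)
  have hg : Continuous g := by fun_prop
  have hf0 : f 0 = 0 := by simp [f]
  have hg0 : g 0 = 0 := by simp [g]
  have hid : cfcₙ (id : ℝ → ℝ) G = G := cfcₙ_id ℝ G
  have mulc : ∀ {f g : ℝ → ℝ}, Continuous f → f 0 = 0 → Continuous g → g 0 = 0 →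
      cfcₙ f G * cfcₙ g G = cfcₙ (fun t => f t * g t) G := fun hf hf0 hg hg0 =>
    (cfcₙ_mul _ _ G hf.continuousOn hf0 hg.continuousOn hg0).symm
  have sa : ∀ f : ℝ → ℝ, star (cfcₙ f G) = cfcₙ f G := fun f =>
    (cfcₙ_predicate (p := IsSelfAdjoint) f G).star_eq
  have hgg : cfcₙ g G * cfcₙ g G = G := by
    rw [mulc hg hg0 hg hg0]
    nth_rewrite 2 [← hid]
    exact cfcₙ_congr fun t ht => Real.mul_self_sqrt (hge t ht)
  refine ⟨cfcₙ f G, cfcₙ g G, sa f, sa g, hgg, ?_, ?_⟩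
  · have e : cfcₙ f G * G * cfcₙ f G = cfcₙ (fun t => f t * id t * f t) G := by
      rw [← mulc (f := fun t => f t * id t) (hf.mul continuous_id) (by simp) hf hf0, ← mulc hf hf0 continuous_id rfl, hid]
    rw [e]
    refine norm_cfcₙ_le fun t ht => ?_
    have h0 := hge t ht
    have h1 : f t * id t * f t = t ^ 2 / (t + ε) ^ 2 := by
      simp only [f, id, abs_of_nonneg h0]
      have := Real.mul_self_sqrt h0
      field_simp
      rw [Real.sq_sqrt h0]; ring
    rw [h1, Real.norm_of_nonneg (by positivity), div_le_one (by positivity)]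
    gcongr
    linarith
  · have hfg : Continuous fun t => f t * g t := hf.mul hg
    have hfg0 : f 0 * g 0 = 0 := by simp [hf0]
    have e : G - G * (cfcₙ f G * cfcₙ g G) - star (cfcₙ f G * cfcₙ g G) * G +
        star (cfcₙ f G * cfcₙ g G) * G * (cfcₙ f G * cfcₙ g G) =
        cfcₙ (fun t => id t - id t * (f t * g t) - f t * g t * id t +
          f t * g t * id t * (f t * g t)) G := by
      have e1 : G * cfcₙ (fun t => f t * g t) G = cfcₙ (fun t => id t * (f t * g t)) G := by
        rw [← mulc continuous_id rfl hfg hfg0, hid]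
      have e2 : cfcₙ (fun t => f t * g t) G * G = cfcₙ (fun t => f t * g t * id t) G := by
        rw [← mulc hfg hfg0 continuous_id rfl, hid]
      rw [mulc hf hf0 hg hg0, sa, e1, e2,
        mulc (f := fun t => f t * g t * id t) (hfg.mul continuous_id) (by simp) hfg hfg0]
      nth_rewrite 1 [← hid]
      rw [← cfcₙ_sub _ _ G (by fun_prop) rfl (by fun_prop) (by simp),
        ← cfcₙ_sub _ _ G (by fun_prop) (by simp) (by fun_prop) (by simp),
        ← cfcₙ_add _ _ G (by fun_prop) (by simp) (by fun_prop) (by simp)]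
    rw [e]
    refine norm_cfcₙ_le fun t ht => ?_
    have h0 := hge t ht
    have h1 : f t * g t = t / (t + ε) := by
      simp only [f, g, abs_of_nonneg h0]
      rw [div_mul_eq_mul_div, Real.mul_self_sqrt h0]
    have h2 : id t - id t * (f t * g t) - f t * g t * id t + f t * g t * id t * (f t * g t) =
        t * ε ^ 2 / (t + ε) ^ 2 := by
      rw [h1]
      simp only [id]
      field_simp
      ring
    rw [h2, Real.norm_of_nonneg (by positivity), div_le_iff₀ (by positivity)]
    nlinarith [mul_nonneg h0 hε.le, mul_nonneg h0 h0, mul_pos hε hε,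
      mul_nonneg hε.le (mul_nonneg h0 h0), mul_nonneg hε.le (mul_nonneg h0 hε.le),
      mul_pos hε (mul_pos hε hε)]

/-- A `*`-representation of a `C⋆`-algebra on a semi-inner product space is contractive. -/
lemma norm_rep_le {V : Type*} [SeminormedAddCommGroup V] [InnerProductSpace ℂ V]
    (ρ : A →ₗ[ℂ] V →ₗ[ℂ] V) (hmul : ∀ a b x, ρ (a * b) x = ρ a (ρ b x))
    (hstar : ∀ a x y, inner ℂ (ρ a x) y = inner ℂ x (ρ (star a) y)) (a : A) (x : V) :
    ‖ρ a x‖ ≤ ‖a‖ * ‖x‖ := by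
  have key : ∀ a : A, ‖a‖ ≤ 1 → ‖ρ a x‖ ≤ ‖x‖ := by
    intro a ha
    obtain ⟨c, hc, hca⟩ := exists_one_sub_sq ha
    have h1 : inner ℂ (ρ a x) (ρ a x) =
        inner ℂ x (ρ c x) + inner ℂ x (ρ c x) - inner ℂ (ρ c x) (ρ c x) := by
      rw [hstar, ← hmul, hca, hstar c, hc, ← hmul]
      simp only [map_sub, map_add, LinearMap.sub_apply, LinearMap.add_apply, inner_sub_right,
        inner_add_right]
    -- Combined with `h1` this gives ‖x‖² − ‖ρ(a)x‖² = ‖x − ρ(c)x‖² ≥ 0.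
    have h2 := norm_sub_sq (𝕜 := ℂ) x (ρ c x)
    have h3 := congrArg Complex.re h1
    simp only [Complex.sub_re, Complex.add_re] at h3
    have e1 : (inner ℂ (ρ a x) (ρ a x)).re = ‖ρ a x‖ ^ 2 := inner_self_eq_norm_sq (𝕜 := ℂ) _
    have e2 : (inner ℂ (ρ c x) (ρ c x)).re = ‖ρ c x‖ ^ 2 := inner_self_eq_norm_sq (𝕜 := ℂ) _
    rw [e1, e2] at h3
    simp only [RCLike.re_to_complex] at h2
    refine le_of_sq_le_sq ?_ (norm_nonneg _)
    nlinarith [sq_nonneg ‖x - ρ c x‖]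
  rcases eq_or_ne a 0 with rfl | ha
  · simp
  · have hn : (0 : ℝ) < ‖a‖ := norm_pos_iff.2 ha
    have := key (((‖a‖⁻¹ : ℝ) : ℂ) • a) (by
      rw [norm_smul, Complex.norm_real, norm_inv, norm_norm, inv_mul_cancel₀ hn.ne'])
    rw [map_smul, LinearMap.smul_apply, norm_smul, Complex.norm_real, norm_inv, norm_norm,
      inv_mul_le_iff₀ hn] at this
    exact this

end CStar

/-! ## Matrices over a represented `C⋆`-algebra -/

section MatRep

variable {M : Type*} [NonUnitalCStarAlgebra M] {n : ℕ}
variable {H : Type*} [NormedAddCommGroup H] [InnerProductSpace ℂ H] [CompleteSpace H]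

/-- The representation of `M_n(M)` on `Hⁿ` given by a representation of `M` on `H`. -/
def matRep (σ : M →⋆ₙₐ[ℂ] (H →L[ℂ] H)) : CStarMatrix (Fin n) (Fin n) M →⋆ₙₐ[ℂ]
    (PiLp 2 (fun _ : Fin n => H) →L[ℂ] PiLp 2 (fun _ : Fin n => H)) where
  toFun A :=
    { toFun := fun v => WithLp.toLp 2 fun i => ∑ j, σ (A i j) (v j)
      map_add' := fun v w => by ext i; simp [Finset.sum_add_distrib]
      map_smul' := fun c v => by ext i; simp [Finset.smul_sum]
      cont := by fun_prop }
  map_smul' c A := by ext v i; simp [Finset.smul_sum]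
  map_zero' := by ext v i; simp
  map_add' A B := by ext v i; simp [Finset.sum_add_distrib]
  map_mul' A B := by
    ext v i
    simp only [CStarMatrix.mul_apply, map_sum, map_mul, ContinuousLinearMap.coe_mk',
      LinearMap.coe_mk, AddHom.coe_mk, FunLike.coe_sum, Finset.sum_apply,
      mul_apply_eq_comp]
    rw [Finset.sum_comm]
  map_star' A := by
    rw [ContinuousLinearMap.star_eq_adjoint, ContinuousLinearMap.eq_adjoint_iff]
    intro v w
    simp only [PiLp.inner_apply, ContinuousLinearMap.coe_mk', LinearMap.coe_mk, AddHom.coe_mk,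
      sum_inner, inner_sum, CStarMatrix.star_apply, map_star,
      ContinuousLinearMap.star_eq_adjoint, ContinuousLinearMap.adjoint_inner_left]
    exact Finset.sum_comm

lemma matRep_apply (σ : M →⋆ₙₐ[ℂ] (H →L[ℂ] H)) (A : CStarMatrix (Fin n) (Fin n) M)
    (v : PiLp 2 (fun _ : Fin n => H)) (i : Fin n) :
    matRep σ A v i = ∑ j, σ (A i j) (v j) := rfl

end MatRep

/-! ## Completely contractive maps induce contractions of the interior tensor product -/

section Contraction

variable {M : Type u} [NonUnitalCStarAlgebra M] [PartialOrder M] [StarOrderedRing M]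
variable {E : Type*} [AddCommGroup E] [Module ℂ E] [SMul Mᵐᵒᵖ E] [Norm E] [CStarModule Mᵐᵒᵖ E]
variable {H : Type*} [NormedAddCommGroup H] [InnerProductSpace ℂ H] [CompleteSpace H]

variable (M) in
/-- The Gram matrix `(⟨ξ_i, ξ_j⟩)`. -/
def gram {n : ℕ} (ξ : Fin n → E) : CStarMatrix (Fin n) (Fin n) M :=
  CStarMatrix.ofMatrix fun i j => hinner M (ξ i) (ξ j)

lemma gram_apply {n : ℕ} (ξ : Fin n → E) (i j : Fin n) :
    gram M ξ i j = hinner M (ξ i) (ξ j) := rfl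

/-- The row `ξ a` for a matrix `a` over `M`. -/
def rowMul {n : ℕ} (ξ : Fin n → E) (a : CStarMatrix (Fin n) (Fin n) M) (j : Fin n) : E :=
  ∑ i, op (a i j) • ξ i

lemma hinner_rowMul_right {n : ℕ} (ξ η : Fin n → E) (a : CStarMatrix (Fin n) (Fin n) M)
    (i j : Fin n) :
    hinner M (η i) (rowMul ξ a j) = ∑ l, hinner M (η i) (ξ l) * a l j := by
  simp only [rowMul, hinner_sum_right, hinner_op_smul_right]

lemma hinner_rowMul_left {n : ℕ} (ξ η : Fin n → E) (a : CStarMatrix (Fin n) (Fin n) M)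
    (i j : Fin n) :
    hinner M (rowMul ξ a i) (η j) = ∑ l, star (a l i) * hinner M (ξ l) (η j) := by
  simp only [rowMul, hinner_sum_left, hinner_op_smul_left]

lemma gram_rowMul {n : ℕ} (ξ : Fin n → E) (a : CStarMatrix (Fin n) (Fin n) M) :
    gram M (rowMul ξ a) = star a * gram M ξ * a := by
  apply CStarMatrix.ext
  intro i j
  rw [gram_apply, hinner_rowMul_right]
  simp only [hinner_rowMul_left, CStarMatrix.mul_apply, CStarMatrix.star_apply, gram_apply]

lemma hinner_sub_right (ξ η ζ : E) : hinner M ξ (η - ζ) = hinner M ξ η - hinner M ξ ζ :=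
  map_sub (hinnerRight M ξ) η ζ

lemma hinner_sub_left (ξ η ζ : E) : hinner M (ξ - η) ζ = hinner M ξ ζ - hinner M η ζ :=
  map_sub (hinnerLeft M ζ) ξ η

/-- This is (1 − a)⋆ G (1 − a) written out, since M need not have a unit. -/
lemma gram_sub_rowMul {n : ℕ} (ξ : Fin n → E) (a : CStarMatrix (Fin n) (Fin n) M) :
    gram M (fun i => ξ i - rowMul ξ a i) =
      gram M ξ - gram M ξ * a - star a * gram M ξ + star a * gram M ξ * a := by
  rw [← gram_rowMul]
  apply CStarMatrix.ext
  intro i j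
  simp only [CStarMatrix.add_apply, CStarMatrix.sub_apply, CStarMatrix.mul_apply,
    CStarMatrix.star_apply, gram_apply, hinner_sub_left, hinner_sub_right]
  rw [hinner_rowMul_right, hinner_rowMul_left]
  abel

/-- A completely contractive map applied to a row. -/
lemma norm_row_le {T : E →ₗ[ℂ] (H →L[ℂ] H)} (hT : CompletelyContractive M T) {n : ℕ}
    (ξ : Fin n → E) (h : PiLp 2 (fun _ : Fin n => H)) :
    ‖∑ j, T (ξ j) (h j)‖ ≤ √‖gram M ξ‖ * ‖h‖ := by
  rcases n with _ | n
  · simp; positivity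
  -- Complete contractivity concerns square matrices, so the row is padded with zero rows; this does
  -- not change the Gram matrix.
  let Ξ : Fin (n + 1) → Fin (n + 1) → E := fun i j => if i = 0 then ξ j else 0
  have hcc := hT (n + 1) Ξ
  have hG : (CStarMatrix.ofMatrix fun i j => ∑ l, hinner M (Ξ l i) (Ξ l j) :
      CStarMatrix (Fin (n + 1)) (Fin (n + 1)) M) = gram M ξ := by
    apply CStarMatrix.ext
    intro i j
    rw [gram_apply]
    change ∑ l, hinner M (Ξ l i) (Ξ l j) = _
    rw [Finset.sum_eq_single 0]
    · simp [Ξ]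
    · intro l _ hl
      simp only [Ξ, if_neg hl]
      exact map_zero (hinnerRight M (0 : E))
    · simp
  rw [hG] at hcc
  set A : CStarMatrix (Fin (n + 1)) (Fin (n + 1)) (H →L[ℂ] H) :=
    CStarMatrix.ofMatrix fun i j => T (Ξ i j)
  let ι : (H →L[ℂ] H) →⋆ₙₐ[ℂ] (H →L[ℂ] H) := NonUnitalStarAlgHom.id ℂ _
  have h1 : ∑ j, T (ξ j) (h j) = matRep ι A h 0 := by
    rw [matRep_apply]
    refine Finset.sum_congr rfl fun j _ => ?_
    change _ = T (Ξ 0 j) (h j)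
    simp [Ξ]
  rw [h1]
  refine (PiLp.norm_apply_le _ _).trans ((ContinuousLinearMap.le_opNorm _ _).trans ?_)
  gcongr
  exact (NonUnitalStarAlgHom.norm_apply_le (matRep ι) A).trans hcc

variable (σ : M →⋆ₙₐ[ℂ] (H →L[ℂ] H))

/-- Write the row ξ as (ξa)b + (ξ − ξab) with b = G^(1/2) and a ≈ G^(-1/2), where G is its Gram
matrix. The row ξa has a Gram matrix of norm at most 1, and covariance moves b onto h, where σ(b)h
has exactly the norm of ∑ ξ_i ⊗ h_i. The remaining row has a Gram matrix of norm at most ε. -/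
lemma norm_lift_le {T : E →ₗ[ℂ] (H →L[ℂ] H)} (hcc : CompletelyContractive M T)
    (hT : ∀ ξ a, T (op a • ξ) = T ξ * σ a) (t : E ⊗[ℂ] H) :
    ‖TensorProduct.lift (ContinuousLinearMap.coeLM ℂ ∘ₗ T) t‖ ≤ 1 * ‖toInterior E σ t‖ := by
  obtain ⟨n, ξ, h, rfl⟩ := exists_fin_sum_tmul t
  let v : PiLp 2 (fun _ : Fin n => H) := WithLp.toLp 2 h
  obtain ⟨Q, hQ⟩ := exists_gram_eq M ξ
  have hG : gram M ξ = star (CStarMatrix.ofMatrix Q) * CStarMatrix.ofMatrix Q := by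
    apply CStarMatrix.ext
    intro i j
    rw [gram_apply, hQ]
    simp only [CStarMatrix.mul_apply, CStarMatrix.star_apply]
    rfl
  have e0 : TensorProduct.lift (ContinuousLinearMap.coeLM ℂ ∘ₗ T) (∑ i, ξ i ⊗ₜ[ℂ] h i) =
      ∑ j, T (ξ j) (v j) := by
    rw [map_sum]; rfl
  rw [e0, one_mul]
  have hrow : ∀ (a : CStarMatrix (Fin n) (Fin n) M) (w : PiLp 2 (fun _ : Fin n => H)),
      ∑ j, T (rowMul ξ a j) (w j) = ∑ i, T (ξ i) (matRep σ a w i) := by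
    intro a w
    simp only [rowMul, map_sum, hT, FunLike.coe_sum, Finset.sum_apply, matRep_apply,
      mul_apply_eq_comp]
    exact Finset.sum_comm
  refine le_of_forall_pos_le_add fun δ hδ => ?_
  -- The Gram matrix bound ε costs √ε ‖v‖ in norm.
  obtain ⟨ε, hε, hεδ⟩ : ∃ ε : ℝ, 0 < ε ∧ √ε * ‖v‖ ≤ δ := by
    refine ⟨(δ / (‖v‖ + 1)) ^ 2, by positivity, ?_⟩
    rw [Real.sqrt_sq (by positivity), div_mul_eq_mul_div, div_le_iff₀ (by positivity)]
    nlinarith [norm_nonneg v]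
  obtain ⟨a, b, ha, hb, hbb, h1, h2⟩ := exists_approx_inv_sqrt (CStarMatrix.ofMatrix Q) hε
  rw [← hG] at hbb h1 h2
  rw [← gram_sub_rowMul] at h2
  have hsplit : ∑ j, T (ξ j) (v j) = ∑ j, T (rowMul ξ a j) (matRep σ b v j) +
      ∑ j, T (ξ j - rowMul ξ (a * b) j) (v j) := by
    simp only [map_sub, sub_apply, Finset.sum_sub_distrib]
    rw [hrow, hrow, map_mul, mul_apply_eq_comp]
    abel
  have hb2 : ‖matRep σ b v‖ = ‖toInterior E σ (∑ i, ξ i ⊗ₜ[ℂ] h i)‖ := by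
    rw [← sq_eq_sq₀ (norm_nonneg _) (norm_nonneg _), norm_sq_toInterior]
    have : inner ℂ (matRep σ b v) (matRep σ b v) = inner ℂ v (matRep σ (gram M ξ) v) := by
      have hadj := ContinuousLinearMap.adjoint_inner_left (matRep σ b) (matRep σ b v) v
      rw [← ContinuousLinearMap.star_eq_adjoint, ← map_star, hb] at hadj
      rw [← hbb, map_mul, mul_apply_eq_comp, hadj]
    have e : ‖matRep σ b v‖ ^ 2 = (inner ℂ (matRep σ b v) (matRep σ b v)).re :=
      (inner_self_eq_norm_sq (𝕜 := ℂ) _).symm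
    rw [e, this]
    congr 1
    simp only [PiLp.inner_apply, matRep_apply, map_sum, LinearMap.sum_apply, tensorForm_tmul,
      inner_sum, gram_apply]
    exact Finset.sum_comm
  rw [hsplit]
  refine (norm_add_le _ _).trans (add_le_add ?_ ?_)
  · refine (norm_row_le hcc _ _).trans ?_
    rw [gram_rowMul, ha, hb2]
    exact mul_le_of_le_one_left (norm_nonneg _) (Real.sqrt_le_one.2 h1)
  · refine (norm_row_le hcc _ _).trans (le_trans ?_ hεδ)
    gcongr

lemma tilde_tmul {T : E →ₗ[ℂ] (H →L[ℂ] H)} (hcc : CompletelyContractive M T)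
    (hT : ∀ ξ a, T (op a • ξ) = T ξ * σ a) (ξ : E) (h : H) :
    tilde σ T (toInterior E σ (ξ ⊗ₜ h)) = T ξ h :=
  extendOfNorm_toInterior σ (norm_lift_le σ hcc hT) _

lemma norm_tilde_le {T : E →ₗ[ℂ] (H →L[ℂ] H)} (hcc : CompletelyContractive M T)
    (hT : ∀ ξ a, T (op a • ξ) = T ξ * σ a) : ‖tilde σ T‖ ≤ 1 :=
  opNorm_extendOfNorm_toInterior σ zero_le_one (norm_lift_le σ hcc hT)

end Contraction

/-! ## Normality of vector functionals -/

section Normal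


variable {H : Type*} [NormedAddCommGroup H] [InnerProductSpace ℂ H] [CompleteSpace H]

lemma inner_apply_mono {x y : H →L[ℂ] H} (hxy : x ≤ y) (h : H) :
    inner ℂ h (x h) ≤ inner ℂ h (y h) := by
  have := (ContinuousLinearMap.le_def x y).1 hxy |>.inner_nonneg_right h
  rwa [sub_apply, inner_sub_right, sub_nonneg] at this

/-- A bounded increasing net of positive operators converges weakly. -/
lemma exists_tendsto_of_monotone {ι : Type*} [Preorder ι] [IsDirectedOrder ι] [Nonempty ι]
    {z : ι → H →L[ℂ] H} (hz : Monotone z) (h0 : ∀ i, 0 ≤ z i) {c : H →L[ℂ] H}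
    (hc : ∀ i, z i ≤ c) :
    ∃ b : H →L[ℂ] H, ∀ h, Tendsto (fun i => inner ℂ h (z i h)) atTop (𝓝 (inner ℂ h (b h))) := by
  have hreal : ∀ i h, inner ℂ h (z i h) = (((inner ℂ h (z i h)).re : ℝ) : ℂ) := fun i h => by
    have := ((ContinuousLinearMap.nonneg_iff_isPositive _).1 (h0 i)).inner_nonneg_right h
    exact Complex.eq_re_of_ofReal_le (r := 0) (by rw [Complex.ofReal_zero]; exact this)
  have hdiag : ∀ h, ∃ l : ℂ, Tendsto (fun i => inner ℂ h (z i h)) atTop (𝓝 l) := fun h => by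
    have hm : Monotone fun i => (inner ℂ h (z i h)).re := fun i j hij =>
      (Complex.le_def.1 (inner_apply_mono (hz hij) h)).1
    have hb : BddAbove (Set.range fun i => (inner ℂ h (z i h)).re) :=
      ⟨(inner ℂ h (c h)).re, by
        rintro _ ⟨i, rfl⟩
        exact (Complex.le_def.1 (inner_apply_mono (hc i) h)).1⟩
    refine ⟨_, (((Complex.continuous_ofReal.tendsto _).comp
      (tendsto_atTop_ciSup hm hb)).congr fun i => (hreal i h).symm)⟩
  have hsymm : ∀ i h, inner ℂ (z i h) h = inner ℂ h (z i h) := fun i h => by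
    have := ((ContinuousLinearMap.nonneg_iff_isPositive _).1 (h0 i)).isSymmetric
    exact this h h
  -- Polarization: the off-diagonal coefficients are combinations of four convergent diagonal ones,
  -- and their limits form a bounded sesquilinear form.
  have hpol : ∀ h k, ∃ l : ℂ, Tendsto (fun i => inner ℂ (z i h) k) atTop (𝓝 l) := fun h k => by
    obtain ⟨l1, h1⟩ := hdiag (h + k)
    obtain ⟨l2, h2⟩ := hdiag (h - k)
    obtain ⟨l3, h3⟩ := hdiag (h + Complex.I • k)
    obtain ⟨l4, h4⟩ := hdiag (h - Complex.I • k)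
    refine ⟨_, ((((h1.sub h2).sub (h3.const_mul Complex.I)).add
      (h4.const_mul Complex.I)).div_const 4).congr fun i => ?_⟩
    rw [← hsymm, ← hsymm, ← hsymm, ← hsymm]
    exact (inner_map_polarization' (z i).toLinearMap h k).symm
  choose B hB using hpol
  have hnorm : ∀ i, ‖z i‖ ≤ ‖c‖ := fun i =>
    CStarAlgebra.norm_le_norm_of_nonneg_of_le (h0 i) (hc i)
  let B' : H →ₗ⋆[ℂ] H →ₗ[ℂ] ℂ := LinearMap.mk₂'ₛₗ (starRingEnd ℂ) (RingHom.id ℂ) B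
    (fun h h' k => tendsto_nhds_unique (hB _ _)
      (((hB h k).add (hB h' k)).congr fun i => by rw [map_add, inner_add_left]))
    (fun a h k => tendsto_nhds_unique (hB _ _)
      (((hB h k).const_mul _).congr fun i => by rw [map_smul, inner_smul_left]))
    (fun h k k' => tendsto_nhds_unique (hB _ _)
      (((hB h k).add (hB h k')).congr fun i => by rw [inner_add_right]))
    (fun a h k => tendsto_nhds_unique (hB _ _)
      (((hB h k).const_mul _).congr fun i => by rw [inner_smul_right]; rfl))
  have hbound : ∀ h k, ‖B' h k‖ ≤ ‖c‖ * ‖h‖ * ‖k‖ := fun h k => by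
    refine le_of_tendsto (hB h k).norm (Eventually.of_forall fun i => ?_)
    refine (norm_inner_le_norm _ _).trans ?_
    gcongr
    exact (ContinuousLinearMap.le_opNorm _ _).trans (by gcongr; exact hnorm i)
  let Bc : H →L⋆[ℂ] H →L[ℂ] ℂ := B'.mkContinuous₂ ‖c‖ hbound
  refine ⟨InnerProductSpace.continuousLinearMapOfBilin Bc, fun h => ?_⟩
  have h1 : inner ℂ (InnerProductSpace.continuousLinearMapOfBilin Bc h) h = B h h :=
    InnerProductSpace.continuousLinearMapOfBilin_apply Bc h h
  have h2 := hB h h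
  rw [← h1] at h2
  have h3 := (Complex.continuous_conj.tendsto _).comp h2
  rw [inner_conj_symm] at h3
  refine h3.congr fun i => ?_
  simp

/-- Vector functionals on `B(H)` are normal. -/
lemma scottContinuous_inner_apply (h : H) :
    ScottContinuous fun x : H →L[ℂ] H => inner ℂ h (x h) := by
  intro d hne hdir a ha
  obtain ⟨x₀, hx₀⟩ := hne
  -- On the part of d above x₀, the differences x − x₀ form an increasing net of positive operators
  -- bounded by a − x₀.
  let ι := {x : H →L[ℂ] H // x ∈ d ∧ x₀ ≤ x}
  have : Nonempty ι := ⟨⟨x₀, hx₀, le_rfl⟩⟩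
  have : IsDirectedOrder ι := ⟨fun x y => by
    obtain ⟨z, hz, hxz, hyz⟩ := hdir x.1 x.2.1 y.1 y.2.1
    exact ⟨⟨z, hz, x.2.2.trans hxz⟩, hxz, hyz⟩⟩
  obtain ⟨b, hb⟩ := exists_tendsto_of_monotone (z := fun x : ι => x.1 - x₀)
    (fun x y hxy => sub_le_sub_right (α := H →L[ℂ] H) hxy x₀) (fun x => sub_nonneg.2 x.2.2)
    (c := a - x₀) (fun x => sub_le_sub_right (ha.1 x.2.1) x₀)
  have hmono : ∀ h, ∀ x y : ι, x ≤ y →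
      inner ℂ h ((x.1 - x₀) h) ≤ inner ℂ h ((y.1 - x₀) h) := fun h x y hxy =>
    inner_apply_mono (sub_le_sub_right (α := H →L[ℂ] H) hxy x₀) h
  have hub : ∀ (x : ι) h, inner ℂ h ((x.1 - x₀) h) ≤ inner ℂ h (b h) := fun x h =>
    ge_of_tendsto (hb h) ((Filter.eventually_ge_atTop x).mono fun y hy => hmono h x y hy)
  -- The weak limit b + x₀ is an upper bound of d, hence dominates the least one; so the supremum is
  -- tested by limits of ⟨h, xh⟩.
  have hle : a ≤ b + x₀ := by
    refine ha.2 fun x hx => ?_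
    obtain ⟨y, hy, hxy, hx₀y⟩ := hdir x hx x₀ hx₀
    refine hxy.trans ?_
    rw [ContinuousLinearMap.le_def, ContinuousLinearMap.isPositive_iff_complex]
    intro k
    have h1 := hub ⟨y, hy, hx₀y⟩ k
    have h2 : 0 ≤ inner ℂ k ((b + x₀ - y) k) := by
      have e : (b + x₀ - y) k = b k - (y - x₀) k := by
        simp only [sub_apply, add_apply]
        abel
      rw [e, inner_sub_right]
      exact sub_nonneg.2 h1
    have h3 : inner ℂ ((b + x₀ - y) k) k = inner ℂ k ((b + x₀ - y) k) := by
      rw [← inner_conj_symm]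
      exact Complex.conj_eq_iff_im.2 (Complex.le_def.1 h2).2.symm
    rw [h3]
    exact ⟨(Complex.eq_re_of_ofReal_le (r := 0) (by rw [Complex.ofReal_zero]; exact h2)).symm, (Complex.le_def.1 h2).1⟩
  refine ⟨?_, fun c hc => ?_⟩
  · rintro _ ⟨x, hx, rfl⟩
    exact inner_apply_mono (ha.1 hx) h
  · refine (inner_apply_mono hle h).trans ?_
    rw [add_apply, inner_add_right]
    have : inner ℂ h (b h) ≤ c - inner ℂ h (x₀ h) := by
      refine le_of_tendsto (hb h) (Eventually.of_forall fun x => ?_)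
      rw [sub_apply, inner_sub_right]
      exact sub_le_sub_right (hc ⟨x.1, x.2.1, rfl⟩) _
    exact le_sub_iff_add_le.1 this

end Normal

/-! ## Ampliations -/

section Ampliate

variable {M : Type u} [NonUnitalCStarAlgebra M] [PartialOrder M] [StarOrderedRing M]
variable {E : Type*} [AddCommGroup E] [Module ℂ E] [SMul Mᵐᵒᵖ E] [Norm E] [CStarModule Mᵐᵒᵖ E]
variable {F : Type*} [AddCommGroup F] [Module ℂ F] [SMul Mᵐᵒᵖ F] [Norm F] [CStarModule Mᵐᵒᵖ F]
variable {H : Type*} [NormedAddCommGroup H] [InnerProductSpace ℂ H] [CompleteSpace H]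
variable (σ : M →⋆ₙₐ[ℂ] (H →L[ℂ] H))

/-- The map `A ⊗ I` of algebraic tensor products is bounded by `C`. -/
def AmpBound (A : E →ₗ[ℂ] F) (C : ℝ) : Prop :=
  ∀ t, ‖toInterior F σ (TensorProduct.map A LinearMap.id t)‖ ≤ C * ‖toInterior E σ t‖

variable {σ}

lemma AmpBound.ampliate_toInterior {A : E →ₗ[ℂ] F} {C : ℝ} (hA : AmpBound σ A C) (t : E ⊗[ℂ] H) :
    ampliate σ A (toInterior E σ t) = toInterior F σ (TensorProduct.map A LinearMap.id t) :=
  extendOfNorm_toInterior (f := toInterior F σ ∘ₗ TensorProduct.map A LinearMap.id) σ hA t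

lemma AmpBound.ampliate_tmul {A : E →ₗ[ℂ] F} {C : ℝ} (hA : AmpBound σ A C) (ξ : E) (h : H) :
    ampliate σ A (toInterior E σ (ξ ⊗ₜ h)) = toInterior F σ (A ξ ⊗ₜ h) :=
  hA.ampliate_toInterior _

lemma tensorForm_map_left {A : E →ₗ[ℂ] F} {B : F →ₗ[ℂ] E}
    (hAB : ∀ ξ η, hinner M (A ξ) η = hinner M ξ (B η)) (s : E ⊗[ℂ] H) (t : F ⊗[ℂ] H) :
    tensorForm σ (TensorProduct.map A LinearMap.id s) t =
      tensorForm σ s (TensorProduct.map B LinearMap.id t) := by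
  induction s with
  | zero => simp
  | add s s' hs hs' => simp only [map_add, LinearMap.add_apply, hs, hs']
  | tmul ξ h =>
    induction t with
    | zero => simp
    | add t t' ht ht' => simp only [map_add, ht, ht']
    | tmul η k =>
      simp only [TensorProduct.map_tmul, LinearMap.id_apply, tensorForm_tmul, hAB]

/-- A coisometric adjointable map `A` with adjoint `B`. -/
structure IsCoisometry (M : Type u) [NonUnitalCStarAlgebra M] [PartialOrder M]
    {E : Type*} [AddCommGroup E] [Module ℂ E] [SMul Mᵐᵒᵖ E] [Norm E] [CStarModule Mᵐᵒᵖ E]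
    {F : Type*} [AddCommGroup F] [Module ℂ F] [SMul Mᵐᵒᵖ F] [Norm F] [CStarModule Mᵐᵒᵖ F]
    (A : E →ₗ[ℂ] F) (B : F →ₗ[ℂ] E) : Prop where
  hinner_left : ∀ ξ η, hinner M (A ξ) η = hinner M ξ (B η)
  right_inv : ∀ η, A (B η) = η

namespace IsCoisometry

variable {A : E →ₗ[ℂ] F} {B : F →ₗ[ℂ] E} (h : IsCoisometry M A B)
include h

lemma map_map (t : F ⊗[ℂ] H) :
    TensorProduct.map A LinearMap.id (TensorProduct.map B LinearMap.id t) = t := by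
  have e : A ∘ₗ B = LinearMap.id := LinearMap.ext h.right_inv
  rw [← LinearMap.comp_apply, ← TensorProduct.map_comp, e, LinearMap.id_comp,
    TensorProduct.map_id, LinearMap.id_apply]

lemma norm_right (t : F ⊗[ℂ] H) :
    ‖toInterior E σ (TensorProduct.map B LinearMap.id t)‖ = ‖toInterior F σ t‖ := by
  rw [← sq_eq_sq₀ (norm_nonneg _) (norm_nonneg _), norm_sq_toInterior, norm_sq_toInterior,
    ← tensorForm_map_left h.hinner_left, h.map_map]

lemma ampBound_right : AmpBound σ B 1 := fun t => by rw [one_mul, h.norm_right]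

lemma ampBound_left : AmpBound σ A 1 := fun t => by
  rw [one_mul]
  set y := ‖toInterior F σ (TensorProduct.map A LinearMap.id t)‖ with hy
  -- ‖At‖² = ⟨t, BAt⟩ ≤ ‖t‖ ‖BAt‖ = ‖t‖ ‖At‖, as B is isometric (A and B tensored with I).
  have h1 : y ^ 2 ≤ ‖toInterior E σ t‖ * y := by
    rw [hy, norm_sq_toInterior, tensorForm_map_left h.hinner_left, ← inner_toInterior,
      ← h.norm_right]
    exact (Complex.re_le_norm _).trans (norm_inner_le_norm _ _)
  nlinarith [norm_nonneg (toInterior E σ t),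
    norm_nonneg (toInterior F σ (TensorProduct.map A LinearMap.id t))]

lemma ampliate_left_tmul (ξ : E) (x : H) :
    ampliate σ A (toInterior E σ (ξ ⊗ₜ x)) = toInterior F σ (A ξ ⊗ₜ x) :=
  h.ampBound_left.ampliate_tmul ξ x

lemma ampliate_right_tmul (η : F) (x : H) :
    ampliate σ B (toInterior F σ (η ⊗ₜ x)) = toInterior E σ (B η ⊗ₜ x) :=
  h.ampBound_right.ampliate_tmul η x

lemma adjoint_ampliate_left : adjoint (ampliate σ A) = ampliate σ B := by
  refine adjoint_eq_of_tmul fun ξ x η y => ?_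
  rw [h.ampliate_left_tmul, h.ampliate_right_tmul, inner_toInterior_tmul, inner_toInterior_tmul,
    h.hinner_left]

lemma ampliate_comp_ampliate : ampliate σ A ∘L ampliate σ B = ContinuousLinearMap.id ℂ _ := by
  refine interior_ext fun η x => ?_
  rw [ContinuousLinearMap.comp_apply, h.ampliate_right_tmul, h.ampliate_left_tmul, h.right_inv]
  rfl

lemma ampliate_comp_adjoint :
    ampliate σ A ∘L adjoint (ampliate σ A) = ContinuousLinearMap.id ℂ _ := by
  rw [h.adjoint_ampliate_left, h.ampliate_comp_ampliate]

end IsCoisometry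

end Ampliate

/-! ## Interior tensor products of correspondences -/

section Corr

variable {k : AStar} {M : Type u} [NonUnitalCStarAlgebra M] [PartialOrder M] [StarOrderedRing M]
variable {H : Type x} [NormedAddCommGroup H] [InnerProductSpace ℂ H] [CompleteSpace H]
variable (E F : Correspondence.{u, v} k M) (σ : M →⋆ₙₐ[ℂ] (H →L[ℂ] H))

lemma norm_toAlgTensor (t : AlgTensor E σ) : ‖t‖ = ‖toInterior E σ t‖ :=
  (UniformSpace.Completion.norm_coe t).symm

/-- The left action is a `*`-representation on the algebraic tensor product, where boundedness is
not yet known; `norm_rep_le` provides it. -/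
lemma ampBound_lact (a : M) : AmpBound σ (E.lact a) ‖a‖ := fun t => by
  let ρ : M →ₗ[ℂ] AlgTensor E σ →ₗ[ℂ] AlgTensor E σ :=
    (TensorProduct.mapBilinear (RingHom.id ℂ) E H E H).flip LinearMap.id ∘ₗ E.lact
  have hmul : ∀ a b (s : E ⊗[ℂ] H), TensorProduct.map (E.lact (a * b)) LinearMap.id s =
      TensorProduct.map (E.lact a) LinearMap.id (TensorProduct.map (E.lact b) LinearMap.id s) := by
    intro a b s
    have e : E.lact (a * b) = E.lact a ∘ₗ E.lact b := LinearMap.ext (E.lact_mul a b)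
    rw [e, ← LinearMap.comp_apply, ← TensorProduct.map_comp, LinearMap.id_comp]
  have := norm_rep_le ρ hmul (fun a s t => tensorForm_map_left (E.hinner_lact a) s t) a t
  exact (norm_toAlgTensor E σ _).symm.trans_le
    (this.trans_eq (congrArg (‖a‖ * ·) (norm_toAlgTensor E σ t)))

/-- The representation of `M` on `E ⊗_σ H` by the left action of `M` on `E`. -/
def leftRep : M →⋆ₙₐ[ℂ] (InteriorTensor E σ →L[ℂ] InteriorTensor E σ) where
  toFun a := ampliate σ (E.lact a)
  map_smul' c a := interior_ext fun ξ h => by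
    rw [smul_apply, (ampBound_lact E σ _).ampliate_tmul, (ampBound_lact E σ _).ampliate_tmul,
      map_smul, LinearMap.smul_apply, ← TensorProduct.smul_tmul', map_smul]
    rfl
  map_zero' := interior_ext fun ξ h => by
    rw [(ampBound_lact E σ _).ampliate_tmul, map_zero, LinearMap.zero_apply,
      TensorProduct.zero_tmul, map_zero, zero_apply]
  map_add' a b := interior_ext fun ξ h => by
    rw [add_apply, (ampBound_lact E σ _).ampliate_tmul, (ampBound_lact E σ _).ampliate_tmul,
      (ampBound_lact E σ _).ampliate_tmul, map_add, LinearMap.add_apply, TensorProduct.add_tmul,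
      map_add]
  map_mul' a b := interior_ext fun ξ h => by
    simp only [(ampBound_lact E σ _).ampliate_tmul, E.lact_mul, mul_apply_eq_comp]
  map_star' a := by
    rw [ContinuousLinearMap.star_eq_adjoint]
    refine (adjoint_eq_of_tmul fun ξ h η k => ?_).symm
    rw [(ampBound_lact E σ _).ampliate_tmul, (ampBound_lact E σ _).ampliate_tmul,
      inner_toInterior_tmul, inner_toInterior_tmul, E.hinner_lact]

lemma leftRep_tmul (a : M) (ξ : E) (h : H) :
    leftRep E σ a (toInterior E σ (ξ ⊗ₜ h)) = toInterior E σ (E.lact a ξ ⊗ₜ h) :=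
  (ampBound_lact E σ a).ampliate_tmul ξ h

variable {E F} (P : CorrTensor.{u, v, w} E F)

lemma tensorForm_creation (ξ ξ' : E) (s t : F ⊗[ℂ] H) :
    tensorForm σ (TensorProduct.map (P.tmul ξ) LinearMap.id s)
      (TensorProduct.map (P.tmul ξ') LinearMap.id t) =
      tensorForm σ s (TensorProduct.map (F.lact (hinner M ξ ξ')) LinearMap.id t) := by
  induction s with
  | zero => simp
  | add s s' hs hs' => simp only [map_add, LinearMap.add_apply, hs, hs']
  | tmul η h =>
    induction t with
    | zero => simp
    | add t t' ht ht' => simp only [map_add, ht, ht']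
    | tmul η' k =>
      simp only [TensorProduct.map_tmul, LinearMap.id_apply, tensorForm_tmul, P.hinner_tmul]

/-- The creation operator c of ξ satisfies c⋆c = ⟨ξ, ξ⟩ acting from the left, which is bounded by
`ampBound_lact`. -/
lemma ampBound_creation (ξ : E) : AmpBound σ (P.tmul ξ) √‖hinner M ξ ξ‖ := fun t => by
  refine le_of_sq_le_sq ?_ (by positivity)
  rw [mul_pow, Real.sq_sqrt (norm_nonneg _), norm_sq_toInterior, tensorForm_creation,
    ← inner_toInterior]
  refine (Complex.re_le_norm _).trans ((norm_inner_le_norm _ _).trans ?_)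
  have := ampBound_lact F σ (hinner M ξ ξ) t
  nlinarith [norm_nonneg (toInterior F σ t)]

/-- The operators `F ⊗_σ H → (E ⊗ F) ⊗_σ H`, `η ⊗ h ↦ (ξ ⊗ η) ⊗ h`. -/
def creation : E →ₗ[ℂ] (InteriorTensor F σ →L[ℂ] InteriorTensor P.prod σ) where
  toFun ξ := ampliate σ (P.tmul ξ)
  map_add' ξ ξ' := interior_ext fun η h => by
    rw [add_apply, (ampBound_creation σ P _).ampliate_tmul, (ampBound_creation σ P _).ampliate_tmul,
      (ampBound_creation σ P _).ampliate_tmul, map_add, LinearMap.add_apply,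
      TensorProduct.add_tmul, map_add]
  map_smul' c ξ := interior_ext fun η h => by
    rw [smul_apply, (ampBound_creation σ P _).ampliate_tmul,
      (ampBound_creation σ P _).ampliate_tmul, map_smul, LinearMap.smul_apply,
      ← TensorProduct.smul_tmul', map_smul]
    rfl

lemma creation_tmul (ξ : E) (η : F) (h : H) :
    creation σ P ξ (toInterior F σ (η ⊗ₜ h)) = toInterior P.prod σ (P.tmul ξ η ⊗ₜ h) :=
  (ampBound_creation σ P ξ).ampliate_tmul η h

/-- This relation is what makes ξ ⊗ s ↦ (creation by ξ) s isometric for the inner product defined by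
`leftRep`. -/
lemma inner_creation (ξ ξ' : E) (s t : InteriorTensor F σ) :
    inner ℂ (creation σ P ξ s) (creation σ P ξ' t) =
      inner ℂ s (leftRep F σ (hinner M ξ ξ') t) := by
  refine (denseRange_toInterior (E := F) σ).induction_on₂
    (p := fun s t => inner ℂ (creation σ P ξ s) (creation σ P ξ' t) =
      inner ℂ s (leftRep F σ (hinner M ξ ξ') t)) ?_ ?_ s t
  · exact isClosed_eq (by fun_prop) (by fun_prop)
  · intro s t
    have e1 := (ampBound_creation σ P ξ).ampliate_toInterior s
    have e2 := (ampBound_creation σ P ξ').ampliate_toInterior t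
    have e3 := (ampBound_lact F σ (hinner M ξ ξ')).ampliate_toInterior t
    change inner ℂ (ampliate σ (P.tmul ξ) _) (ampliate σ (P.tmul ξ') _) =
      inner ℂ _ (ampliate σ (F.lact _) _)
    rw [e1, e2, e3, inner_toInterior, inner_toInterior, tensorForm_creation]

/-- The isometry `E ⊗ (F ⊗_σ H) → (E ⊗ F) ⊗_σ H`. -/
def assocTensor : InteriorTensor E (leftRep F σ) →L[ℂ] InteriorTensor P.prod σ :=
  liftTensor (leftRep F σ) (creation σ P)

lemma assocTensor_tmul (ξ : E) (s : InteriorTensor F σ) :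
    assocTensor σ P (toInterior E (leftRep F σ) (ξ ⊗ₜ s)) = creation σ P ξ s :=
  liftTensor_tmul _ (inner_creation σ P) ξ s

lemma norm_assocTensor (z : InteriorTensor E (leftRep F σ)) : ‖assocTensor σ P z‖ = ‖z‖ :=
  norm_liftTensor _ (inner_creation σ P) z

variable {σ}

/-- If `N` is dense in `E`, then `N ⊗ H` is norm dense in `E ⊗_σ H`. -/
lemma exists_norm_toInterior_lt (hσ : k.IsRep σ) {N : Submodule ℂ E} (hN : k.DenseIn M N)
    (ξ : E) (h : H) {ε : ℝ} (hε : 0 < ε) :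
    ∃ η ∈ N, ‖toInterior E σ ((ξ - η) ⊗ₜ h)‖ < ε := by
  cases k with
  | cstar =>
    obtain ⟨η, hη, hd⟩ := Metric.mem_closure_iff.1 (hN ξ) (ε / (‖h‖ + 1)) (by positivity)
    refine ⟨η, hη, (norm_toInterior_tmul_le σ _ _).trans_lt ?_⟩
    have e : √‖hinner M (ξ - η) (ξ - η)‖ = ‖ξ - η‖ :=
      (CStarModule.norm_eq_sqrt_norm_inner_self (A := Mᵐᵒᵖ) (ξ - η)).symm
    rw [e, ← dist_eq_norm]
    rw [lt_div_iff₀ (by positivity)] at hd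
    nlinarith [dist_nonneg (x := ξ) (y := η)]
  | wstar =>
    -- With this functional, ω(⟨ξ − η, ξ − η⟩) is the squared norm of (ξ − η) ⊗ h.
    let ω : M →ₗ[ℂ] ℂ :=
      { toFun := fun a => inner ℂ h (σ a h)
        map_add' := fun a b => by simp
        map_smul' := fun c a => by simp }
    have hω : ScottContinuous ω := (hσ.2 rfl).comp (scottContinuous_inner_apply h)
    obtain ⟨η, hη, hlt⟩ := hN ξ ω hω (ε ^ 2) (by positivity)
    refine ⟨η, hη, lt_of_pow_lt_pow_left₀ 2 hε.le ?_⟩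
    rw [norm_sq_toInterior, tensorForm_tmul]
    exact hlt

/-- The range contains all (ξ ⊗ η) ⊗ h. Density of the span of the ξ ⊗ η in the sense of `DenseIn`
becomes norm density after tensoring with h. -/
lemma denseRange_assocTensor (hσ : k.IsRep σ) : DenseRange (assocTensor σ P) := by
  let R : Submodule ℂ (InteriorTensor P.prod σ) :=
    (LinearMap.range (assocTensor σ P).toLinearMap).topologicalClosure
  have hR : IsClosed (R : Set (InteriorTensor P.prod σ)) :=
    Submodule.isClosed_topologicalClosure _
  have h1 : ∀ ζ ∈ Submodule.span ℂ {ζ : P.prod | ∃ ξ η, ζ = P.tmul ξ η}, ∀ h : H,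
      toInterior P.prod σ (ζ ⊗ₜ h) ∈ R := by
    intro ζ hζ h
    induction hζ using Submodule.span_induction with
    | mem ζ hζ =>
      obtain ⟨ξ, η, rfl⟩ := hζ
      refine Submodule.le_topologicalClosure _ ⟨toInterior E _ (ξ ⊗ₜ toInterior F σ (η ⊗ₜ h)), ?_⟩
      exact (assocTensor_tmul σ P _ _).trans (creation_tmul σ P _ _ _)
    | zero => simp
    | add ζ ζ' _ _ hζ hζ' =>
      rw [TensorProduct.add_tmul, map_add]
      exact R.add_mem hζ hζ'
    | smul c ζ _ hζ =>
      rw [← TensorProduct.smul_tmul', map_smul]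
      exact R.smul_mem c hζ
  have h2 : ∀ (ζ : P.prod) (h : H), toInterior P.prod σ (ζ ⊗ₜ h) ∈ R := by
    intro ζ h
    refine hR.closure_subset (Metric.mem_closure_iff.2 fun ε hε => ?_)
    obtain ⟨η, hη, hlt⟩ := exists_norm_toInterior_lt hσ P.dense_tmul ζ h hε
    refine ⟨_, h1 η hη h, ?_⟩
    rwa [dist_eq_norm, ← map_sub, ← TensorProduct.sub_tmul]
  have h3 : ∀ t, toInterior P.prod σ t ∈ R := by
    intro t
    induction t with
    | zero => simp
    | add s t hs ht => rw [map_add]; exact R.add_mem hs ht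
    | tmul ζ h => exact h2 ζ h
  intro z
  have hz := denseRange_toInterior (E := P.prod) σ z
  exact (closure_minimal (by rintro _ ⟨t, rfl⟩; exact h3 t) hR) hz

lemma assocTensor_comp_adjoint (hσ : k.IsRep σ) :
    assocTensor σ P ∘L adjoint (assocTensor σ P) = ContinuousLinearMap.id ℂ _ :=
  comp_adjoint_of_isometry_of_denseRange (norm_assocTensor σ P) (denseRange_assocTensor P hσ)

end Corr

open Filter

/-! ## The Fock module -/

namespace SubproductSystem

variable {k : AStar} {M : Type u} [NonUnitalCStarAlgebra M] [PartialOrder M]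
variable (𝒳 : SubproductSystem.{u, v, w} k M)

/-- The inclusion `X(n) → F_X`. -/
def incl (n : ℕ) : 𝒳.X n →ₗ[ℂ] 𝒳.Fock := DirectSum.lof ℂ ℕ (fun n => 𝒳.X n) n

variable {𝒳}

lemma coord_incl_self (n : ℕ) (ξ : 𝒳.X n) : coord n (𝒳.incl n ξ) = ξ :=
  DirectSum.component.lof_self (R := ℂ) (M := fun n => 𝒳.X n) n ξ

lemma coord_incl_of_ne {n m : ℕ} (h : m ≠ n) (ξ : 𝒳.X m) : coord n (𝒳.incl m ξ) = 0 :=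
  (DirectSum.component.of (R := ℂ) (M := fun n => 𝒳.X n) n m ξ).trans (dif_neg h)

lemma fock_induction {p : 𝒳.Fock → Prop} (h0 : p 0) (hi : ∀ n ξ, p (𝒳.incl n ξ))
    (ha : ∀ ξ η, p ξ → p η → p (ξ + η)) (ξ : 𝒳.Fock) : p ξ :=
  DirectSum.induction_on (motive := p) ξ h0 hi ha

lemma shift_incl (n m : ℕ) (ζ : 𝒳.X n) (ξ : 𝒳.X m) :
    𝒳.shift n ζ (𝒳.incl m ξ) = 𝒳.incl (n + m) (𝒳.mul n m ζ ξ) :=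
  DirectSum.toModule_lof (M := fun n => 𝒳.X n) (N := 𝒳.Fock) ℂ
    (φ := fun m => 𝒳.incl (n + m) ∘ₗ 𝒳.mul n m ζ) m ξ

variable [StarOrderedRing M]

/-- In this form, the coordinate maps get their bounds and adjoints on F_X ⊗_σ H from the same
lemmas as the U_{n,m}. -/
lemma isCoisometry_coord (n : ℕ) : IsCoisometry M (coord n : 𝒳.Fock →ₗ[ℂ] 𝒳.X n) (𝒳.incl n) where
  hinner_left ξ η := by
    have h := 𝒳.fockInner_eq ξ (𝒳.incl n η) (s := {n}) fun m hm =>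
      coord_incl_of_ne (fun h => hm (by simp [h])) η
    rw [Finset.sum_singleton, coord_incl_self] at h
    exact h.symm
  right_inv := coord_incl_self n

lemma isCoisometry_U (n m p : ℕ) (h : n + m = p) :
    IsCoisometry M (𝒳.U n m p h) (𝒳.Uadj n m p h) :=
  ⟨𝒳.hinner_U n m p h, 𝒳.U_Uadj n m p h⟩

variable {H : Type x} [NormedAddCommGroup H] [InnerProductSpace ℂ H] [CompleteSpace H]
variable (σ : M →⋆ₙₐ[ℂ] (H →L[ℂ] H))

lemma norm_incl (n : ℕ) (z : InteriorTensor (𝒳.X n) σ) : ‖ampliate σ (𝒳.incl n) z‖ = ‖z‖ := by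
  refine congrFun ((denseRange_toInterior σ).equalizer
    (ampliate σ (𝒳.incl n)).continuous.norm continuous_norm ?_) z
  refine funext fun t => ?_
  simp only [Function.comp_apply]
  rw [(isCoisometry_coord n).ampBound_right.ampliate_toInterior,
    (isCoisometry_coord n).norm_right]

variable (𝒳) in
/-- The isometric embedding `X(n) ⊗_σ H → F_X ⊗_σ H`. -/
def inclTensor (n : ℕ) : InteriorTensor (𝒳.X n) σ →ₗᵢ[ℂ] 𝒳.FockTensor σ :=
  ⟨(ampliate σ (𝒳.incl n)).toLinearMap, norm_incl σ n⟩

variable (𝒳) in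
lemma inclTensor_tmul (n : ℕ) (ξ : 𝒳.X n) (h : H) :
    𝒳.inclTensor σ n (toInterior _ σ (ξ ⊗ₜ h)) = toInterior 𝒳.Fock σ (𝒳.incl n ξ ⊗ₜ h) :=
  (isCoisometry_coord n).ampliate_right_tmul ξ h

variable (𝒳) in
/-- The projection `F_X ⊗_σ H → X(n) ⊗_σ H`. -/
def coordTensor (n : ℕ) : 𝒳.FockTensor σ →L[ℂ] InteriorTensor (𝒳.X n) σ :=
  ampliate σ (coord n)

variable (𝒳) in
lemma coordTensor_tmul (n : ℕ) (ξ : 𝒳.Fock) (h : H) :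
    𝒳.coordTensor σ n (toInterior _ σ (ξ ⊗ₜ h)) = toInterior _ σ (coord n ξ ⊗ₜ h) :=
  (isCoisometry_coord n).ampliate_left_tmul ξ h

variable (𝒳) in
lemma adjoint_coordTensor (n : ℕ) :
    adjoint (𝒳.coordTensor σ n) = (𝒳.inclTensor σ n).toContinuousLinearMap :=
  (isCoisometry_coord n).adjoint_ampliate_left

variable (𝒳) in
lemma coordTensor_inclTensor_of_ne {n m : ℕ} (hnm : m ≠ n) (z : InteriorTensor (𝒳.X m) σ) :
    𝒳.coordTensor σ n (𝒳.inclTensor σ m z) = 0 := by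
  have : 𝒳.coordTensor σ n ∘L (𝒳.inclTensor σ m).toContinuousLinearMap = 0 := by
    refine interior_ext fun ξ h => ?_
    have e := 𝒳.inclTensor_tmul σ m ξ h
    rw [ContinuousLinearMap.comp_apply]
    refine (congrArg _ e).trans ?_
    rw [𝒳.coordTensor_tmul, coord_incl_of_ne hnm, TensorProduct.zero_tmul, map_zero]
    rfl
  exact DFunLike.congr_fun this z

variable (𝒳) in
lemma orthogonalFamily_inclTensor :
    OrthogonalFamily ℂ (fun n => InteriorTensor (𝒳.X n) σ) (𝒳.inclTensor σ) := by
  intro n m hnm y z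
  have h := ContinuousLinearMap.adjoint_inner_right (𝒳.coordTensor σ m) (𝒳.inclTensor σ n y) z
  rw [adjoint_coordTensor, 𝒳.coordTensor_inclTensor_of_ne σ hnm, inner_zero_left] at h
  exact h

variable (𝒳) in
/-- The projection of `F_X ⊗_σ H` onto the components of degree `< N`. -/
def cutoff (N : ℕ) : 𝒳.FockTensor σ →L[ℂ] 𝒳.FockTensor σ :=
  ∑ n ∈ Finset.range N, (𝒳.inclTensor σ n).toContinuousLinearMap ∘L 𝒳.coordTensor σ n

variable (𝒳) in
lemma cutoff_apply (N : ℕ) (z : 𝒳.FockTensor σ) :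
    𝒳.cutoff σ N z = ∑ n ∈ Finset.range N, 𝒳.inclTensor σ n (𝒳.coordTensor σ n z) := by
  rw [cutoff, FunLike.coe_sum, Finset.sum_apply]; rfl

variable (𝒳) in
lemma norm_sq_cutoff (N : ℕ) (z : 𝒳.FockTensor σ) :
    ‖𝒳.cutoff σ N z‖ ^ 2 = ∑ n ∈ Finset.range N, ‖𝒳.coordTensor σ n z‖ ^ 2 := by
  rw [cutoff_apply]
  exact (𝒳.orthogonalFamily_inclTensor σ).norm_sum (fun n => 𝒳.coordTensor σ n z) _

variable (𝒳) in
-- Both ‖Pz‖² and ⟨Pz, z⟩ equal the sum of the squared norms of the first N coordinates.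
lemma norm_cutoff_le (N : ℕ) (z : 𝒳.FockTensor σ) : ‖𝒳.cutoff σ N z‖ ≤ ‖z‖ := by
  have h1 : inner ℂ (𝒳.cutoff σ N z) z =
      ∑ n ∈ Finset.range N, inner ℂ (𝒳.coordTensor σ n z) (𝒳.coordTensor σ n z) := by
    rw [cutoff_apply, sum_inner]
    refine Finset.sum_congr rfl fun n _ => ?_
    have := ContinuousLinearMap.adjoint_inner_left (𝒳.coordTensor σ n) z (𝒳.coordTensor σ n z)
    rwa [adjoint_coordTensor] at this
  have h2 : ‖𝒳.cutoff σ N z‖ ^ 2 = (inner ℂ (𝒳.cutoff σ N z) z).re := by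
    rw [norm_sq_cutoff, h1, Complex.re_sum]
    exact Finset.sum_congr rfl fun n _ => (inner_self_eq_norm_sq (𝕜 := ℂ) _).symm
  have h3 := (Complex.re_le_norm _).trans (norm_inner_le_norm (𝕜 := ℂ) (𝒳.cutoff σ N z) z)
  rw [← h2] at h3
  nlinarith [norm_nonneg z, norm_nonneg (𝒳.cutoff σ N z)]

/-- A property of the finite vectors in `F_X ⊗ H` that can be checked on homogeneous vectors. -/
lemma fock_tensor_induction {p : 𝒳.Fock ⊗[ℂ] H → Prop} (h0 : p 0)
    (hi : ∀ n ξ h, p (𝒳.incl n ξ ⊗ₜ h)) (ha : ∀ s t, p s → p t → p (s + t))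
    (t : 𝒳.Fock ⊗[ℂ] H) : p t := by
  induction t with
  | zero => exact h0
  | add s t hs ht => exact ha s t hs ht
  | tmul ξ h =>
    induction ξ using fock_induction with
    | h0 => rw [TensorProduct.zero_tmul]; exact h0
    | hi n ξ => exact hi n ξ h
    | ha ξ η hξ hη => rw [TensorProduct.add_tmul]; exact ha _ _ hξ hη

variable (𝒳) in
/-- A sum of operators on the components agrees with its `n`-th term on the `n`-th component. -/
lemma sum_coordTensor_incl {K : Type*} [NormedAddCommGroup K] [InnerProductSpace ℂ K]
    (C : ∀ n, InteriorTensor (𝒳.X n) σ →L[ℂ] K) {n N : ℕ} (hn : n < N) (ξ : 𝒳.X n) (h : H) :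
    ∑ m ∈ Finset.range N, C m (𝒳.coordTensor σ m (toInterior _ σ (𝒳.incl n ξ ⊗ₜ h))) =
      C n (toInterior _ σ (ξ ⊗ₜ h)) := by
  rw [Finset.sum_eq_single n]
  · rw [coordTensor_tmul, coord_incl_self]
  · intro m _ hm
    rw [coordTensor_tmul, coord_incl_of_ne hm.symm, TensorProduct.zero_tmul, map_zero, map_zero]
  · simp [hn]

variable (𝒳) in
lemma eventually_cutoff (t : 𝒳.Fock ⊗[ℂ] H) :
    ∀ᶠ N in atTop, 𝒳.cutoff σ N (toInterior _ σ t) = toInterior _ σ t := by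
  induction t using fock_tensor_induction with
  | h0 => simp
  | hi n ξ h =>
    filter_upwards [eventually_gt_atTop n] with N hN
    rw [cutoff_apply]
    refine (𝒳.sum_coordTensor_incl σ
      (fun m => (𝒳.inclTensor σ m).toContinuousLinearMap) hN ξ h).trans ?_
    exact 𝒳.inclTensor_tmul σ n ξ h
  | ha s t hs ht =>
    filter_upwards [hs, ht] with N hs ht
    rw [map_add, map_add, hs, ht]

variable (𝒳) in
-- The cutoffs are contractions that eventually fix each vector of a dense subspace.
lemma tendsto_cutoff (z : 𝒳.FockTensor σ) :
    Tendsto (fun N => 𝒳.cutoff σ N z) atTop (𝓝 z) := by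
  rw [Metric.tendsto_atTop']
  intro ε hε
  obtain ⟨t, ht⟩ := (denseRange_toInterior (E := 𝒳.Fock) σ).exists_dist_lt z (half_pos hε)
  obtain ⟨N, hN⟩ := eventually_atTop.1 (𝒳.eventually_cutoff σ t)
  refine ⟨N, fun n hn => ?_⟩
  have h1 : 𝒳.cutoff σ n z - z =
      𝒳.cutoff σ n (z - toInterior _ σ t) - (z - toInterior _ σ t) := by
    rw [map_sub, hN n hn.le]; abel
  rw [dist_eq_norm] at ht ⊢
  rw [h1]
  have h2 := norm_sub_le (𝒳.cutoff σ n (z - toInterior _ σ t)) (z - toInterior _ σ t)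
  have h3 := 𝒳.norm_cutoff_le σ n (z - toInterior _ σ t)
  linarith

/-- The multiplication by `ζ ∈ X(n)` is bounded on `X(m) ⊗_σ H`. -/
lemma ampBound_mul (n m : ℕ) (ζ : 𝒳.X n) : AmpBound σ (𝒳.mul n m ζ) √‖hinner M ζ ζ‖ := by
  intro t
  have e : TensorProduct.map (𝒳.mul n m ζ) (LinearMap.id : H →ₗ[ℂ] H) t =
      TensorProduct.map (𝒳.U n m (n + m) rfl) LinearMap.id
        (TensorProduct.map ((𝒳.tens n m).tmul ζ) LinearMap.id t) := by
    rw [← LinearMap.comp_apply, ← TensorProduct.map_comp, LinearMap.id_comp]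
    rfl
  rw [e]
  refine ((isCoisometry_U n m (n + m) rfl).ampBound_left _).trans ?_
  rw [one_mul]
  exact ampBound_creation σ (𝒳.tens n m) ζ t

/-- The shift sends degree m to degree n + m, so its blocks have orthogonal ranges and a common
bound for the blocks bounds the whole operator. -/
lemma ampBound_shift (n : ℕ) (ζ : 𝒳.X n) : AmpBound σ (𝒳.shift n ζ) √‖hinner M ζ ζ‖ := by
  intro t
  have key : ∀ᶠ N in atTop, toInterior _ σ (TensorProduct.map (𝒳.shift n ζ) LinearMap.id t) =
      ∑ m ∈ Finset.range N, 𝒳.inclTensor σ (n + m) (ampliate σ (𝒳.mul n m ζ)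
        (𝒳.coordTensor σ m (toInterior _ σ t))) := by
    induction t using fock_tensor_induction with
    | h0 => simp
    | hi m ξ h =>
      filter_upwards [eventually_gt_atTop m] with N hN
      rw [TensorProduct.map_tmul, shift_incl, LinearMap.id_apply]
      refine Eq.trans ?_ (𝒳.sum_coordTensor_incl σ (fun m =>
        (𝒳.inclTensor σ (n + m)).toContinuousLinearMap ∘L ampliate σ (𝒳.mul n m ζ)) hN ξ h).symm
      rw [ContinuousLinearMap.comp_apply, (ampBound_mul σ n m ζ).ampliate_tmul]
      exact (𝒳.inclTensor_tmul σ _ _ _).symm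
    | ha s t hs ht =>
      filter_upwards [hs, ht] with N hs ht
      simp only [map_add, hs, ht, Finset.sum_add_distrib]
  obtain ⟨N, hN⟩ := key.exists
  refine le_of_sq_le_sq ?_ (by positivity)
  rw [hN]
  have h1 := ((𝒳.orthogonalFamily_inclTensor σ).comp (add_right_injective n)).norm_sum
    (fun m => ampliate σ (𝒳.mul n m ζ) (𝒳.coordTensor σ m (toInterior _ σ t))) (Finset.range N)
  refine h1.trans_le ?_
  have h2 : ∀ m, ‖ampliate σ (𝒳.mul n m ζ) (𝒳.coordTensor σ m (toInterior _ σ t))‖ ^ 2 ≤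
      √‖hinner M ζ ζ‖ ^ 2 * ‖𝒳.coordTensor σ m (toInterior _ σ t)‖ ^ 2 := fun m => by
    rw [← mul_pow]
    gcongr
    refine (ContinuousLinearMap.le_opNorm _ _).trans ?_
    gcongr
    exact opNorm_extendOfNorm_toInterior σ (Real.sqrt_nonneg _) (ampBound_mul σ n m ζ)
  refine (Finset.sum_le_sum fun m _ => h2 m).trans ?_
  rw [← Finset.mul_sum, ← norm_sq_cutoff, mul_pow]
  gcongr
  exact 𝒳.norm_cutoff_le σ N _

end SubproductSystem

open Filter

/-! ### Products of operators with their adjoints -/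

section Functor

variable {M : Type u} [NonUnitalCStarAlgebra M] [PartialOrder M] [StarOrderedRing M]
variable {E : Type*} [AddCommGroup E] [Module ℂ E] [SMul Mᵐᵒᵖ E] [Norm E] [CStarModule Mᵐᵒᵖ E]
variable {H : Type*} [NormedAddCommGroup H] [InnerProductSpace ℂ H] [CompleteSpace H]
variable {K : Type*} [NormedAddCommGroup K] [InnerProductSpace ℂ K] [CompleteSpace K]
variable {σ : M →⋆ₙₐ[ℂ] (H →L[ℂ] H)} {τ : M →⋆ₙₐ[ℂ] (K →L[ℂ] K)}

lemma idTensor_comp_adjoint {C : H →L[ℂ] K} (hC : ∀ a h, C (σ a h) = τ a (C h)) :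
    idTensor E σ τ C ∘L adjoint (idTensor E σ τ C) = idTensor E τ τ (C ∘L adjoint C) := by
  have hC' := intertwine_adjoint hC
  rw [adjoint_idTensor hC]
  refine interior_ext fun ξ h => ?_
  rw [ContinuousLinearMap.comp_apply, idTensor_tmul hC', idTensor_tmul hC,
    idTensor_tmul (C := C ∘L adjoint C)
      (fun a h => by simp only [ContinuousLinearMap.comp_apply, hC', hC])]
  rfl

end Functor

section Hilbert

variable {H : Type*} [NormedAddCommGroup H] [InnerProductSpace ℂ H] [CompleteSpace H]
variable {K : Type*} [NormedAddCommGroup K] [InnerProductSpace ℂ K] [CompleteSpace K]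

lemma re_inner_comp_adjoint (A : K →L[ℂ] H) (h : H) :
    (inner ℂ ((A ∘L adjoint A) h) h).re = ‖adjoint A h‖ ^ 2 := by
  rw [ContinuousLinearMap.comp_apply, ← ContinuousLinearMap.adjoint_inner_right]
  exact inner_self_eq_norm_sq (𝕜 := ℂ) _

lemma norm_le_one_of_adjoint {A : K →L[ℂ] H} (hA : ∀ h, ‖adjoint A h‖ ≤ ‖h‖) : ‖A‖ ≤ 1 := by
  rw [← ContinuousLinearMap.adjoint.norm_map A]
  exact ContinuousLinearMap.opNorm_le_bound _ zero_le_one fun h => by rw [one_mul]; exact hA h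

end Hilbert

/-! ### The Poisson transform of an invariant projection -/

namespace Rep

variable {k : AStar} {M : Type u} [NonUnitalCStarAlgebra M] [PartialOrder M] [StarOrderedRing M]
variable {𝒳 : SubproductSystem.{u, v, w} k M} {H : Type x} [NormedAddCommGroup H]
  [InnerProductSpace ℂ H] [CompleteSpace H] (T : Rep 𝒳 H)

lemma tilde_tmul (n : ℕ) (ξ : 𝒳.X n) (h : H) :
    T.tilde n (toInterior _ T.σ (ξ ⊗ₜ h)) = T.T n ξ h :=
  CovariantRep.tilde_tmul T.σ (T.completelyContractive n) (T.T_right n) ξ h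

lemma norm_tilde_le (n : ℕ) : ‖T.tilde n‖ ≤ 1 :=
  CovariantRep.norm_tilde_le T.σ (T.completelyContractive n) (T.T_right n)

lemma inner_T_zero (ξ η : 𝒳.X 0) (h k : H) :
    inner ℂ (T.T 0 ξ h) (T.T 0 η k) = inner ℂ h (T.σ (hinner M ξ η) k) := by
  obtain ⟨a, rfl⟩ := 𝒳.vac.surjective ξ
  obtain ⟨b, rfl⟩ := 𝒳.vac.surjective η
  rw [T.T_zero, T.T_zero, 𝒳.hinner_vac, map_mul, map_star, mul_apply_eq_comp,
    ContinuousLinearMap.star_eq_adjoint, ContinuousLinearMap.adjoint_inner_right]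

/-- In degree zero T̃_0 (a ⊗ h) = σ(a)h is isometric since T_0 is a `*`-homomorphism, and it has
dense range since σ is nondegenerate. -/
lemma tilde_zero_comp_adjoint : T.tilde 0 ∘L adjoint (T.tilde 0) = ContinuousLinearMap.id ℂ H := by
  refine comp_adjoint_of_isometry_of_denseRange (norm_liftTensor T.σ T.inner_T_zero) ?_
  refine T.isRep.1.mono (Submodule.span_le (p := LinearMap.range (T.tilde 0).toLinearMap).2 ?_)
  rintro _ ⟨a, h, rfl⟩
  exact ⟨toInterior _ T.σ (𝒳.vac a ⊗ₜ h), by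
    rw [← T.T_zero]; exact T.tilde_tmul 0 _ _⟩

/-- `Q` is an orthogonal projection whose range is invariant for `T`. -/
structure Reduces (Q : H →L[ℂ] H) : Prop where
  adjoint_eq : adjoint Q = Q
  idem : ∀ h, Q (Q h) = Q h
  inv : ∀ n ζ h, Q (T.T n ζ (Q h)) = T.T n ζ (Q h)

variable (Q : H →L[ℂ] H)

/-- The operator `ξ ⊗ h ↦ T_n(ξ) Q h`. -/
def cut (n : ℕ) : InteriorTensor (𝒳.X n) T.σ →L[ℂ] H :=
  T.tilde n ∘L idTensor (𝒳.X n) T.σ T.σ Q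

/-- The defect operator `Q - Y₁ Y₁⋆` for `Y₁ (ξ ⊗ h) = T₁(ξ) Q h`. -/
def defect : H →L[ℂ] H := Q - T.cut Q 1 ∘L adjoint (T.cut Q 1)

/-- The square root of the defect operator. -/
def sqrtDefect : H →L[ℂ] H := CFC.sqrt (T.defect Q)

lemma adjoint_sqrtDefect : adjoint (T.sqrtDefect Q) = T.sqrtDefect Q := by
  rw [← ContinuousLinearMap.star_eq_adjoint]
  exact (CFC.sqrt_nonneg (T.defect Q)).isSelfAdjoint.star_eq

/-- The `n`-th component of the Poisson transform. -/
def poissonComponent (n : ℕ) : InteriorTensor (𝒳.X n) T.σ →L[ℂ] H :=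
  T.cut Q n ∘L idTensor (𝒳.X n) T.σ T.σ (T.sqrtDefect Q)

/-- The map `ξ ↦ T_n(ξ) B`. -/
def mulRight (B : H →L[ℂ] H) (n : ℕ) : 𝒳.X n →ₗ[ℂ] (H →L[ℂ] H) where
  toFun ξ := T.T n ξ * B
  map_add' ξ η := by rw [map_add, add_mul]
  map_smul' c ξ := by rw [map_smul, smul_mul_assoc, RingHom.id_apply]

/-- The Poisson transform `ξ ↦ T_n(ξ) Q Δ`, `ξ ∈ X(n)`, where `Δ` is the square root of the
defect operator. -/
def poissonMap : 𝒳.Fock →ₗ[ℂ] (H →L[ℂ] H) :=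
  DirectSum.toModule ℂ ℕ (H →L[ℂ] H) (T.mulRight (Q * T.sqrtDefect Q))

/-- The Poisson transform `F_X ⊗ H → H`. -/
def poisson : 𝒳.FockTensor T.σ →L[ℂ] H := liftTensor T.σ (T.poissonMap Q)

lemma poissonMap_incl (n : ℕ) (ξ : 𝒳.X n) (h : H) :
    T.poissonMap Q (𝒳.incl n ξ) h = T.T n ξ (Q (T.sqrtDefect Q h)) := by
  have : T.poissonMap Q (𝒳.incl n ξ) = T.T n ξ * (Q * T.sqrtDefect Q) :=
    DirectSum.toModule_lof (M := fun n => 𝒳.X n) (N := H →L[ℂ] H) ℂ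
      (φ := T.mulRight (Q * T.sqrtDefect Q)) n ξ
  rw [this, mul_apply_eq_comp, mul_apply_eq_comp]

/-! ### The recursion, the defect operator and the telescoping sum -/

namespace Reduces

variable {T Q} (hQ : T.Reduces Q)
include hQ

/-- Degree zero invariance gives Qσ(a)Q = σ(a)Q for all a; taking adjoints for a⋆ gives Qσ(a)Q =
Qσ(a). -/
lemma comm (a : M) (h : H) : Q (T.σ a h) = T.σ a (Q h) := by
  have h1 : ∀ a h, Q (T.σ a (Q h)) = T.σ a (Q h) := fun a h => by
    rw [← T.T_zero, hQ.inv]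
  refine ext_inner_right ℂ fun y => ?_
  have e : T.σ a = adjoint (T.σ (star a)) := by
    rw [map_star, ContinuousLinearMap.star_eq_adjoint, ContinuousLinearMap.adjoint_adjoint]
  rw [← h1]
  nth_rewrite 1 2 [← hQ.adjoint_eq]
  rw [ContinuousLinearMap.adjoint_inner_left, ContinuousLinearMap.adjoint_inner_left, e,
    ContinuousLinearMap.adjoint_inner_left, ContinuousLinearMap.adjoint_inner_left]
  nth_rewrite 2 [← hQ.adjoint_eq]
  rw [ContinuousLinearMap.adjoint_inner_left, h1]

lemma norm_apply_le (h : H) : ‖Q h‖ ≤ ‖h‖ := by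
  have h1 : inner ℂ (Q h) (Q h) = inner ℂ h (Q h) := by
    nth_rewrite 1 [← hQ.adjoint_eq]
    rw [ContinuousLinearMap.adjoint_inner_left, hQ.idem]
  have h2 : ‖Q h‖ ^ 2 = (inner ℂ h (Q h)).re := by
    rw [← h1]; exact (inner_self_eq_norm_sq (𝕜 := ℂ) _).symm
  have h3 := (Complex.re_le_norm _).trans (norm_inner_le_norm (𝕜 := ℂ) h (Q h))
  rw [← h2] at h3
  nlinarith [norm_nonneg h, norm_nonneg (Q h)]

lemma re_inner_apply (h : H) : (inner ℂ (Q h) h).re = ‖Q h‖ ^ 2 := by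
  have h1 : inner ℂ (Q h) h = inner ℂ (Q h) (Q h) := by
    nth_rewrite 1 [← hQ.idem]
    nth_rewrite 1 [← hQ.adjoint_eq]
    rw [ContinuousLinearMap.adjoint_inner_left]
  rw [h1]
  exact inner_self_eq_norm_sq (𝕜 := ℂ) _

lemma cut_tmul (n : ℕ) (ξ : 𝒳.X n) (h : H) :
    T.cut Q n (toInterior _ T.σ (ξ ⊗ₜ h)) = T.T n ξ (Q h) := by
  rw [cut, ContinuousLinearMap.comp_apply, idTensor_tmul hQ.comm, T.tilde_tmul]

lemma apply_cut (n : ℕ) (z : InteriorTensor (𝒳.X n) T.σ) : Q (T.cut Q n z) = T.cut Q n z := by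
  have : Q ∘L T.cut Q n = T.cut Q n := interior_ext fun ξ h => by
    rw [ContinuousLinearMap.comp_apply, hQ.cut_tmul, hQ.inv]
  exact DFunLike.congr_fun this z

lemma norm_idTensor_le : ∀ n, ‖idTensor (𝒳.X n) T.σ T.σ Q‖ ≤ 1 := fun _ =>
  (CovariantRep.norm_idTensor_le hQ.comm).trans
    (ContinuousLinearMap.opNorm_le_bound _ zero_le_one fun h => by
      rw [one_mul]; exact hQ.norm_apply_le h)

/-- Y_n⋆ = (I ⊗ Q)⋆ T̃_n⋆ with a contraction I ⊗ Q; through this estimate purity passes from T̃_n to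
Y_n. -/
lemma norm_adjoint_cut_le (n : ℕ) (h : H) :
    ‖adjoint (T.cut Q n) h‖ ≤ ‖adjoint (T.tilde n) h‖ := by
  rw [cut, ContinuousLinearMap.adjoint_comp, ContinuousLinearMap.comp_apply]
  refine (ContinuousLinearMap.le_opNorm _ _).trans (mul_le_of_le_one_left (norm_nonneg _) ?_)
  rw [ContinuousLinearMap.adjoint.norm_map]
  exact hQ.norm_idTensor_le n

lemma norm_adjoint_cut_le_norm (n : ℕ) (h : H) : ‖adjoint (T.cut Q n) h‖ ≤ ‖h‖ := by
  refine (hQ.norm_adjoint_cut_le n h).trans ((ContinuousLinearMap.le_opNorm _ _).trans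
    (mul_le_of_le_one_left (norm_nonneg _) ?_))
  rw [ContinuousLinearMap.adjoint.norm_map]
  exact T.norm_tilde_le n

lemma adjoint_cut_apply (n : ℕ) (h : H) : adjoint (T.cut Q n) (Q h) = adjoint (T.cut Q n) h := by
  refine ext_inner_right ℂ fun z => ?_
  rw [ContinuousLinearMap.adjoint_inner_left, ContinuousLinearMap.adjoint_inner_left]
  nth_rewrite 1 [← hQ.adjoint_eq]
  rw [ContinuousLinearMap.adjoint_inner_left, hQ.apply_cut]

/-- Since Q commutes with σ(M), Y_0 = QT̃_0, and T̃_0 is a coisometry. This is the initial term of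
the telescoping sum. -/
lemma cut_zero_comp_adjoint : T.cut Q 0 ∘L adjoint (T.cut Q 0) = Q := by
  have e : T.cut Q 0 = Q ∘L T.tilde 0 := interior_ext fun ξ h => by
    obtain ⟨a, rfl⟩ := 𝒳.vac.surjective ξ
    rw [hQ.cut_tmul, ContinuousLinearMap.comp_apply, T.tilde_tmul, T.T_zero, hQ.comm]
  have h0 := T.tilde_zero_comp_adjoint
  rw [e, ContinuousLinearMap.adjoint_comp, hQ.adjoint_eq]
  refine ContinuousLinearMap.ext fun h => ?_
  have h1 := DFunLike.congr_fun h0 (Q h)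
  simp only [ContinuousLinearMap.comp_apply] at h1 ⊢
  rw [h1]
  exact hQ.idem h

lemma cut_leftRep (n : ℕ) (a : M) (z : InteriorTensor (𝒳.X n) T.σ) :
    T.cut Q n (leftRep (𝒳.X n) T.σ a z) = T.σ a (T.cut Q n z) := by
  have : T.cut Q n ∘L leftRep (𝒳.X n) T.σ a = T.σ a ∘L T.cut Q n := interior_ext fun ξ h => by
    rw [ContinuousLinearMap.comp_apply, ContinuousLinearMap.comp_apply, leftRep_tmul,
      hQ.cut_tmul, hQ.cut_tmul, T.T_left, mul_apply_eq_comp]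
  exact DFunLike.congr_fun this z

/-- The recursion `T̃_{n+1} (U_{n,1} ⊗ I) = T̃_n (I ⊗ T̃₁)`. -/
lemma cut_succ (n : ℕ) :
    T.cut Q (n + 1) ∘L ampliate T.σ (𝒳.U n 1 (n + 1) rfl) ∘L assocTensor T.σ (𝒳.tens n 1) =
      T.cut Q n ∘L idTensor (𝒳.X n) (leftRep (𝒳.X 1) T.σ) T.σ (T.cut Q 1) := by
  refine interior_ext fun ξ s => ?_
  have key : T.cut Q (n + 1) ∘L ampliate T.σ (𝒳.U n 1 (n + 1) rfl) ∘L
      creation T.σ (𝒳.tens n 1) ξ = T.T n ξ ∘L T.cut Q 1 := interior_ext fun η h => by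
    simp only [ContinuousLinearMap.comp_apply]
    rw [creation_tmul, (SubproductSystem.isCoisometry_U n 1 (n + 1) rfl).ampliate_left_tmul,
      hQ.cut_tmul, hQ.cut_tmul]
    exact DFunLike.congr_fun (T.T_mul n 1 ξ η) (Q h)
  have key' := DFunLike.congr_fun key s
  simp only [ContinuousLinearMap.comp_apply] at key' ⊢
  -- The right side carries an extra Q between T_n(ξ) and Y_1; invariance absorbs it through QY_1 =
  -- Y_1.
  rw [assocTensor_tmul, key', idTensor_tmul (hQ.cut_leftRep 1), hQ.cut_tmul, hQ.apply_cut]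

/-- Multiply each side of the recursion by its adjoint: on the left the two coisometries cancel, on
the right (I ⊗ Y_1)(I ⊗ Y_1)⋆ = I ⊗ Y_1Y_1⋆. -/
lemma cut_succ_comp_adjoint (n : ℕ) :
    T.cut Q (n + 1) ∘L adjoint (T.cut Q (n + 1)) =
      T.cut Q n ∘L idTensor (𝒳.X n) T.σ T.σ (T.cut Q 1 ∘L adjoint (T.cut Q 1)) ∘L
        adjoint (T.cut Q n) := by
  have hα := assocTensor_comp_adjoint (𝒳.tens n 1) T.isRep
  have hU := (SubproductSystem.isCoisometry_U (𝒳 := 𝒳) n 1 (n + 1) rfl).ampliate_comp_adjoint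
    (σ := T.σ)
  have h1 := congrArg (fun A => A ∘L adjoint A) (hQ.cut_succ n)
  simp only [ContinuousLinearMap.adjoint_comp] at h1
  rw [← idTensor_comp_adjoint (hQ.cut_leftRep 1)]
  refine ContinuousLinearMap.ext fun h => ?_
  have h2 := DFunLike.congr_fun h1 h
  have hα' := fun z => DFunLike.congr_fun hα z
  have hU' := fun z => DFunLike.congr_fun hU z
  simp only [ContinuousLinearMap.comp_apply, ContinuousLinearMap.id_apply] at h2 hα' hU' ⊢
  rw [hα', hU'] at h2
  exact h2

/-- Y_1⋆ = Y_1⋆Q is a contraction, so ‖Y_1⋆h‖² ≤ ‖Qh‖² = ⟨Qh, h⟩. -/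
lemma defect_nonneg : 0 ≤ T.defect Q := by
  rw [ContinuousLinearMap.nonneg_iff_isPositive, ContinuousLinearMap.isPositive_def']
  refine ⟨?_, fun h => ?_⟩
  · rw [IsSelfAdjoint, ContinuousLinearMap.star_eq_adjoint, defect, map_sub, hQ.adjoint_eq,
      ContinuousLinearMap.adjoint_comp, ContinuousLinearMap.adjoint_adjoint]
  · rw [ContinuousLinearMap.reApplyInnerSelf_apply, defect, sub_apply, inner_sub_left, map_sub]
    have h1 := hQ.re_inner_apply h
    have h2 := re_inner_comp_adjoint (T.cut Q 1) h
    have h3 : ‖adjoint (T.cut Q 1) h‖ ≤ ‖Q h‖ := by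
      rw [← hQ.adjoint_cut_apply]; exact hQ.norm_adjoint_cut_le_norm 1 _
    rw [RCLike.re_to_complex, RCLike.re_to_complex, h1, h2, sub_nonneg]
    gcongr

lemma sqrtDefect_comp_self : T.sqrtDefect Q ∘L T.sqrtDefect Q = T.defect Q :=
  CFC.sqrt_mul_sqrt_self _ hQ.defect_nonneg

lemma comm_cut_adjoint (a : M) (h : H) :
    (T.cut Q 1 ∘L adjoint (T.cut Q 1)) (T.σ a h) =
      T.σ a ((T.cut Q 1 ∘L adjoint (T.cut Q 1)) h) := by
  rw [ContinuousLinearMap.comp_apply, intertwine_adjoint (hQ.cut_leftRep 1), hQ.cut_leftRep]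
  rfl

/-- The square root, as a function of the defect operator, commutes with whatever commutes with the
defect. This is what makes I ⊗ Δ well defined. -/
lemma comm_sqrtDefect (a : M) (h : H) :
    T.sqrtDefect Q (T.σ a h) = T.σ a (T.sqrtDefect Q h) := by
  have h1 : Commute (T.defect Q) (T.σ a) := by
    refine ContinuousLinearMap.ext fun h => ?_
    rw [mul_apply_eq_comp, mul_apply_eq_comp, defect, sub_apply, sub_apply, hQ.comm,
      hQ.comm_cut_adjoint, map_sub]
  exact DFunLike.congr_fun (h1.cfcₙ_nnreal NNReal.sqrt).eq h

lemma poissonComponent_tmul (n : ℕ) (ξ : 𝒳.X n) (h : H) :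
    T.poissonComponent Q n (toInterior _ T.σ (ξ ⊗ₜ h)) = T.T n ξ (Q (T.sqrtDefect Q h)) := by
  rw [poissonComponent, ContinuousLinearMap.comp_apply, idTensor_tmul hQ.comm_sqrtDefect,
    hQ.cut_tmul]

/-- L_nL_n⋆ = Y_n(I ⊗ Δ²)Y_n⋆ with Δ² = Q − Y_1Y_1⋆. The Q is absorbed by Y_n, and the other term is
the recursion for Y_{n+1}Y_{n+1}⋆. -/
lemma poissonComponent_comp_adjoint (n : ℕ) :
    T.poissonComponent Q n ∘L adjoint (T.poissonComponent Q n) =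
      T.cut Q n ∘L adjoint (T.cut Q n) - T.cut Q (n + 1) ∘L adjoint (T.cut Q (n + 1)) := by
  have e : T.cut Q n ∘L idTensor (𝒳.X n) T.σ T.σ (T.defect Q) =
      T.cut Q n - T.cut Q n ∘L
        idTensor (𝒳.X n) T.σ T.σ (T.cut Q 1 ∘L adjoint (T.cut Q 1)) := by
    refine interior_ext fun ξ h => ?_
    rw [sub_apply, ContinuousLinearMap.comp_apply, ContinuousLinearMap.comp_apply,
      idTensor_tmul hQ.comm_cut_adjoint, idTensor_tmul (fun a h => by
        rw [defect, sub_apply, sub_apply, hQ.comm, hQ.comm_cut_adjoint, map_sub]),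
      hQ.cut_tmul, hQ.cut_tmul, hQ.cut_tmul, defect, sub_apply, map_sub, map_sub, hQ.idem]
  have h1 := idTensor_comp_adjoint (E := 𝒳.X n) hQ.comm_sqrtDefect
  rw [T.adjoint_sqrtDefect, hQ.sqrtDefect_comp_self] at h1
  rw [hQ.cut_succ_comp_adjoint, poissonComponent, ContinuousLinearMap.adjoint_comp]
  refine ContinuousLinearMap.ext fun h => ?_
  have h2 := DFunLike.congr_fun h1 (adjoint (T.cut Q n) h)
  have h3 := DFunLike.congr_fun e (adjoint (T.cut Q n) h)
  simp only [ContinuousLinearMap.comp_apply, sub_apply] at h2 h3 ⊢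
  rw [h2, h3]

lemma sum_poissonComponent (N : ℕ) (h : H) :
    ∑ n ∈ Finset.range N, T.poissonComponent Q n (adjoint (T.poissonComponent Q n) h) =
      Q h - T.cut Q N (adjoint (T.cut Q N) h) := by
  have h0 := DFunLike.congr_fun hQ.cut_zero_comp_adjoint h
  have h1 : ∀ n, T.poissonComponent Q n (adjoint (T.poissonComponent Q n) h) =
      T.cut Q n (adjoint (T.cut Q n) h) - T.cut Q (n + 1) (adjoint (T.cut Q (n + 1)) h) :=
    fun n => DFunLike.congr_fun (hQ.poissonComponent_comp_adjoint n) h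
  rw [Finset.sum_congr rfl fun n _ => h1 n,
    Finset.sum_range_sub' (fun n => T.cut Q n (adjoint (T.cut Q n) h))]
  congr 1

/-- The adjoint sends h to the orthogonal sum of the L_n⋆h, n < N, whose squared norm telescopes to
‖Qh‖² − ‖Y_N⋆h‖² ≤ ‖h‖². The bound is uniform in N. -/
lemma norm_sum_poissonComponent_le (N : ℕ) :
    ‖∑ n ∈ Finset.range N, T.poissonComponent Q n ∘L 𝒳.coordTensor T.σ n‖ ≤ 1 := by
  refine norm_le_one_of_adjoint fun h => ?_
  have e : adjoint (∑ n ∈ Finset.range N, T.poissonComponent Q n ∘L 𝒳.coordTensor T.σ n) h =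
      ∑ n ∈ Finset.range N, 𝒳.inclTensor T.σ n (adjoint (T.poissonComponent Q n) h) := by
    simp only [map_sum, ContinuousLinearMap.adjoint_comp, SubproductSystem.adjoint_coordTensor]
    rw [FunLike.coe_sum, Finset.sum_apply]
    rfl
  refine le_of_sq_le_sq ?_ (norm_nonneg h)
  rw [e, (𝒳.orthogonalFamily_inclTensor T.σ).norm_sum
    (fun n => adjoint (T.poissonComponent Q n) h)]
  simp only [← re_inner_comp_adjoint]
  rw [← Complex.re_sum, ← sum_inner]
  have := hQ.sum_poissonComponent N h
  simp only [ContinuousLinearMap.comp_apply]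
  rw [this, inner_sub_left, Complex.sub_re, hQ.re_inner_apply]
  have h2 := re_inner_comp_adjoint (T.cut Q N) h
  rw [ContinuousLinearMap.comp_apply] at h2
  rw [h2]
  have h3 := pow_le_pow_left₀ (norm_nonneg _) (hQ.norm_apply_le h) 2
  nlinarith [sq_nonneg ‖adjoint (T.cut Q N) h‖]

/-- An algebraic tensor involves finitely many degrees, so a finite row with N large already
computes the map. -/
lemma norm_poissonMap_le (t : 𝒳.Fock ⊗[ℂ] H) :
    ‖TensorProduct.lift (ContinuousLinearMap.coeLM ℂ ∘ₗ T.poissonMap Q) t‖ ≤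
      1 * ‖toInterior 𝒳.Fock T.σ t‖ := by
  have key : ∀ᶠ N in atTop, TensorProduct.lift (ContinuousLinearMap.coeLM ℂ ∘ₗ T.poissonMap Q) t =
      (∑ n ∈ Finset.range N, T.poissonComponent Q n ∘L 𝒳.coordTensor T.σ n)
        (toInterior 𝒳.Fock T.σ t) := by
    induction t using SubproductSystem.fock_tensor_induction with
    | h0 => simp
    | hi n ξ h =>
      filter_upwards [eventually_gt_atTop n] with N hN
      rw [FunLike.coe_sum, Finset.sum_apply]
      refine Eq.trans ?_ (𝒳.sum_coordTensor_incl T.σ (T.poissonComponent Q) hN ξ h).symm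
      rw [hQ.poissonComponent_tmul]
      exact T.poissonMap_incl Q n ξ h
    | ha s t hs ht =>
      filter_upwards [hs, ht] with N hs ht
      rw [map_add, map_add, map_add, hs, ht]
  obtain ⟨N, hN⟩ := key.exists
  rw [hN]
  exact (ContinuousLinearMap.le_opNorm _ _).trans
    (mul_le_mul_of_nonneg_right (hQ.norm_sum_poissonComponent_le N) (norm_nonneg _))

lemma poisson_tmul (n : ℕ) (ξ : 𝒳.X n) (h : H) :
    T.poisson Q (toInterior 𝒳.Fock T.σ (𝒳.incl n ξ ⊗ₜ h)) = T.T n ξ (Q (T.sqrtDefect Q h)) :=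
  (extendOfNorm_toInterior T.σ hQ.norm_poissonMap_le _).trans (T.poissonMap_incl Q n ξ h)

lemma poisson_comp_incl (n : ℕ) :
    T.poisson Q ∘L (𝒳.inclTensor T.σ n).toContinuousLinearMap = T.poissonComponent Q n := by
  refine interior_ext fun ξ h => ?_
  rw [hQ.poissonComponent_tmul, ← hQ.poisson_tmul, ContinuousLinearMap.comp_apply]
  exact congrArg _ (𝒳.inclTensor_tmul T.σ n ξ h)

/-- ‖Y_NY_N⋆h‖ ≤ ‖Y_N⋆h‖ ≤ ‖T̃_N⋆h‖ = ⟨T̃_NT̃_N⋆h, h⟩^(1/2), which tends to 0 by purity. -/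
lemma tendsto_cut (hT : T.IsPure) (h : H) :
    Tendsto (fun N => T.cut Q N (adjoint (T.cut Q N) h)) atTop (𝓝 0) := by
  have h1 : ∀ N, ‖T.cut Q N (adjoint (T.cut Q N) h)‖ ≤
      √(‖(T.tilde N ∘L adjoint (T.tilde N)) h‖ * ‖h‖) := fun N => by
    have hn : ‖T.cut Q N‖ ≤ 1 := norm_le_one_of_adjoint (hQ.norm_adjoint_cut_le_norm N)
    refine ((ContinuousLinearMap.le_opNorm _ _).trans
      (mul_le_of_le_one_left (norm_nonneg _) hn)).trans ((hQ.norm_adjoint_cut_le N h).trans ?_)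
    refine Real.le_sqrt_of_sq_le ?_
    rw [← re_inner_comp_adjoint]
    exact (Complex.re_le_norm _).trans (norm_inner_le_norm _ _)
  refine squeeze_zero_norm h1 ?_
  have h2 := ((hT h).norm.mul_const ‖h‖).sqrt
  simpa using h2

/-- The Poisson transform satisfies `Π Π⋆ = Q` if `T` is pure. -/
lemma poisson_comp_adjoint (hT : T.IsPure) : T.poisson Q ∘L adjoint (T.poisson Q) = Q := by
  refine ContinuousLinearMap.ext fun h => ?_
  have h1 := ((T.poisson Q).continuous.tendsto _).comp
    (𝒳.tendsto_cutoff T.σ (adjoint (T.poisson Q) h))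
  -- The n-th coordinate of Π⋆h is L_n⋆h, so the cutoff turns ΠΠ⋆h into the telescoping partial sum.
  have h2 : ∀ N, T.poisson Q (𝒳.cutoff T.σ N (adjoint (T.poisson Q) h)) =
      Q h - T.cut Q N (adjoint (T.cut Q N) h) := fun N => by
    rw [← hQ.sum_poissonComponent, SubproductSystem.cutoff_apply, map_sum]
    refine Finset.sum_congr rfl fun n _ => ?_
    rw [← hQ.poisson_comp_incl, ContinuousLinearMap.adjoint_comp,
      ← SubproductSystem.adjoint_coordTensor, ContinuousLinearMap.adjoint_adjoint,
      SubproductSystem.adjoint_coordTensor]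
    rfl
  have h3 : Tendsto (fun N => Q h - T.cut Q N (adjoint (T.cut Q N) h)) atTop (𝓝 (Q h - 0)) :=
    tendsto_const_nhds.sub (hQ.tendsto_cut hT h)
  rw [sub_zero] at h3
  exact tendsto_nhds_unique (h1.congr h2) h3

/-- On X(m) ⊗ H the transform is T_m(η)QΔh; multiplicativity peels off T_n(ζ) on the left and leaves
QΔ untouched. -/
lemma poisson_comp_shift (n : ℕ) (ζ : 𝒳.X n) :
    T.poisson Q ∘L 𝒳.shiftTensor T.σ n ζ = T.T n ζ ∘L T.poisson Q := by
  refine interior_ext fun η h => ?_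
  rw [ContinuousLinearMap.comp_apply, ContinuousLinearMap.comp_apply,
    SubproductSystem.shiftTensor, (SubproductSystem.ampBound_shift T.σ n ζ).ampliate_tmul]
  induction η using SubproductSystem.fock_induction with
  | h0 => simp
  | hi m η =>
    rw [SubproductSystem.shift_incl, hQ.poisson_tmul, hQ.poisson_tmul, T.T_mul,
      mul_apply_eq_comp]
  | ha η η' hη hη' => simp only [map_add, TensorProduct.add_tmul, hη, hη']

end Reduces

/-! ### Passage between invariant subspaces and projections -/

lemma reduces_starProjection {S : ClosedSubmodule ℂ H} (hS : T.IsInvariant S) :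
    T.Reduces S.toSubmodule.starProjection where
  adjoint_eq := by
    rw [← ContinuousLinearMap.star_eq_adjoint]
    exact (isSelfAdjoint_starProjection S.toSubmodule).star_eq
  idem h := Submodule.starProjection_eq_self_iff.2 (Submodule.starProjection_apply_mem _ _)
  inv n ζ h := by
    refine Submodule.starProjection_eq_self_iff.2 ?_
    have hm : S.toSubmodule.starProjection h ∈ S := Submodule.starProjection_apply_mem _ _
    rcases Nat.eq_zero_or_pos n with rfl | hn
    · obtain ⟨a, rfl⟩ := 𝒳.vac.surjective ζ
      rw [T.T_zero]
      exact hS.1 a _ hm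
    · exact hS.2 n hn ζ _ hm

/-- From ⟨ΦΦ⋆h, h⟩ = ‖Φ⋆h‖², the kernel of P = ΦΦ⋆ is that of Φ⋆. Hence Φ⋆(1 − P) = 0, that is, PΦ =
Φ. -/
lemma mem_of_starProjection_eq {S : ClosedSubmodule ℂ H} {K : Type*} [NormedAddCommGroup K]
    [InnerProductSpace ℂ K] [CompleteSpace K] {Φ : K →L[ℂ] H}
    (hΦ : S.toSubmodule.starProjection = Φ ∘L adjoint Φ) (z : K) : Φ z ∈ S := by
  have h0 : ∀ h, S.toSubmodule.starProjection h = 0 → adjoint Φ h = 0 := fun h hh => by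
    have := re_inner_comp_adjoint Φ h
    rw [← hΦ, hh, inner_zero_left, Complex.zero_re] at this
    exact norm_eq_zero.1 (pow_eq_zero_iff two_ne_zero |>.1 this.symm)
  have hsa : adjoint S.toSubmodule.starProjection = S.toSubmodule.starProjection := by
    rw [← ContinuousLinearMap.star_eq_adjoint]
    exact (isSelfAdjoint_starProjection S.toSubmodule).star_eq
  refine Submodule.starProjection_eq_self_iff (K := S.toSubmodule).1 (ext_inner_left ℂ fun h => ?_)
  have h1 : adjoint Φ (h - S.toSubmodule.starProjection h) = 0 := h0 _ (by
    rw [map_sub, Submodule.starProjection_eq_self_iff.2 (Submodule.starProjection_apply_mem _ _),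
      sub_self])
  rw [map_sub, sub_eq_zero] at h1
  rw [← ContinuousLinearMap.adjoint_inner_left, hsa, ← ContinuousLinearMap.adjoint_inner_left,
    ← ContinuousLinearMap.adjoint_inner_left, h1]

end Rep

end CovariantRep

end

open CovariantRep in
theorem corollary3p2 {k : AStar} {M : Type u} [NonUnitalCStarAlgebra M] [PartialOrder M]
    [StarOrderedRing M] (hM : k.IsAlgebra M) (𝒳 : SubproductSystem.{u, v, w} k M)
    {H : Type x} [NormedAddCommGroup H] [InnerProductSpace ℂ H] [CompleteSpace H]
    (T : Rep 𝒳 H) (hT : T.IsPure) (S : ClosedSubmodule ℂ H) :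
    T.IsInvariant S ↔
      ∃ (D : Type x) (_ : NormedAddCommGroup D) (_ : InnerProductSpace ℂ D) (_ : CompleteSpace D)
        (π : M →⋆ₙₐ[ℂ] (D →L[ℂ] D)) (_ : k.IsRep π) (Φ : 𝒳.FockTensor π →L[ℂ] H),
        S.toSubmodule.starProjection = Φ ∘L ContinuousLinearMap.adjoint Φ ∧
          ∀ (n : ℕ) (ζ : 𝒳.X n), Φ ∘L 𝒳.shiftTensor π n ζ = T.T n ζ ∘L Φ := by
  constructor
  · intro hS
    have hQ := T.reduces_starProjection hS
    -- D is all of H, not the closed range of Δ, so that σ itself serves as π.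
    exact ⟨H, _, _, ‹_›, T.σ, T.isRep, T.poisson S.toSubmodule.starProjection,
      (hQ.poisson_comp_adjoint hT).symm, hQ.poisson_comp_shift⟩
  · rintro ⟨D, _, _, _, π, _, Φ, hΦ, hshift⟩
    have key : ∀ n (ζ : 𝒳.X n), ∀ h ∈ S, T.T n ζ h ∈ S := fun n ζ h hh => by
      have h1 : Φ (ContinuousLinearMap.adjoint Φ h) = h :=
        (DFunLike.congr_fun hΦ h).symm.trans (Submodule.starProjection_eq_self_iff.2 hh)
      have h2 := DFunLike.congr_fun (hshift n ζ) (ContinuousLinearMap.adjoint Φ h)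
      simp only [ContinuousLinearMap.comp_apply] at h2
      rw [h1] at h2
      rw [← h2]
      exact Rep.mem_of_starProjection_eq hΦ _
    -- Invariance under σ(M) is the case n = 0, through the identification of M with X(0).
    exact ⟨fun a h hh => T.T_zero a ▸ key 0 (𝒳.vac a) h hh, fun n _ => key n⟩
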